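/- Let $\mathbb H=\{z\in\mathbb C:\operatorname{Re}z>0\}$, let $\ell\ge 0$ be an integer and let $a\in\mathbb R$. The weighted Bergman space $A^2_\ell$ is the Hilbert space of analytic functions $h:\mathbb H\to\mathbb C$ with $$\|h\|^2=\frac1\pi\int_{-\infty}^{\infty}\int_0^\infty x^\ell|h(x+iy)|^2\,dx\,dy<\infty .$$ Let $\mathcal C_a$ be the conjugate-linear operator $\mathcal C_a h(z)=\overline{h(\overline z+ia)}$ on $A^2_\ell$. A (possibly unbounded) linear operator $T$ in $A^2_\ell$ is called $\mathcal C_a$-selfadjoint if it is densely defined and $\mathcal C_aT^*\mathcal C_a=T$ (with equality of domains). Let $f:\mathbb H\to\mathbb C$ and $g:\mathbb H\to\mathbb H$ be analytic. Let $W_{f,g,\max}$ be the operator $h\mapsto f\cdot(h\circ g)$ with domain $\{h\in A^2_\ell: f\cdot(h\circ g)\in A^2_\ell\}$, and let $W_{f,g}$ be any restriction of $W_{f,g,\max}$ to a linear subspace of its domain. Then $W_{f,g}$ is $\mathcal C_a$-selfadjoint if and only if $W_{f,g}=W_{f,g,\max}$ and either $f\equiv 0$ or one of the following holds: 1. $g(w)=\mu$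 and $f(w)=\dfrac{\delta}{(w+\mu-ia)^{\ell+2}}$ for some $\mu\in\mathbb H$, $\delta\in\mathbb C$; 2. $g(w)=w+\gamma$ and $f(w)=\lambda$ for some $\gamma,\lambda\in\mathbb C$ with $\operatorname{Re}\gamma\ge 0$; 3. $g(w)=-\dfrac{\beta}{\alpha}-\dfrac{2}{\alpha(w-ia)-\beta}$ and $f(w)=\dfrac{\delta}{(\alpha(w-ia)-\beta)^{\ell+2}}$ for some $\alpha\in\mathbb C\setminus\{0\}$ and $\beta,\delta\in\mathbb C$ such that either $\operatorname{Re}\frac{\beta}{\alpha}=\operatorname{Im}\frac1\alpha=0$ and $\operatorname{Re}\frac1\alpha<0$, or $\operatorname{Re}\frac{\beta}{\alpha}<0$ and $\left(\operatorname{Re}\frac{\beta}{\alpha}\right)^2\ge\operatorname{Re}\frac1\alpha+\frac1{|\alpha|}$. In this case the operator $W_{f,g}$ is bounded, that is, its domain is all of $A^2_\ell$ and there is $L>0$ with $\|W_{f,g}h\|\le L\|h\|$ for all $h\in A^2_\ell$. -/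

import Mathlib

open MeasureTheory Filter Topology ComplexConjugate

namespace HalfPlane

/-- The open right half-plane `{z ∈ ℂ : Re z > 0}`. -/
def rhp : Set ℂ := {z | 0 < z.re}

theorem isOpen_rhp : IsOpen rhp := isOpen_lt continuous_const Complex.continuous_re

/-- A function on the right half-plane is holomorphic (analytic) if it is the restriction of a
function on `ℂ` which is complex differentiable at every point of the half-plane. -/
def IsHolo (h : rhp → ℂ) : Prop :=
  ∃ F : ℂ → ℂ, DifferentiableOn ℂ F rhp ∧ ∀ z : rhp, h z = F z

theorem IsHolo.continuous {h : rhp → ℂ} (hh : IsHolo h) : Continuous h := by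
  obtain ⟨F, hF, hE⟩ := hh
  have h2 : h = fun z : rhp => F z := funext hE
  rw [h2]
  exact hF.continuousOn.comp_continuous continuous_subtype_val fun z => z.2

/-- Lebesgue measure on the right half-plane. -/
noncomputable def lebesgue : Measure rhp := (volume : Measure ℂ).comap (↑)

/-- The density `x ^ ℓ / π` at `x + i y`. -/
noncomputable def weight (ℓ : ℕ) (z : rhp) : ENNReal :=
  ENNReal.ofReal ((z : ℂ).re ^ ℓ / Real.pi)

theorem measurable_weight (ℓ : ℕ) : Measurable (weight ℓ) := by
  unfold weight; fun_prop

theorem weight_ne_zero (ℓ : ℕ) (z : rhp) : weight ℓ z ≠ 0 := by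
  have : 0 < (z : ℂ).re := z.2
  unfold weight
  rw [Ne, ENNReal.ofReal_eq_zero, not_le]
  positivity

/-- The measure `(1 / π) x ^ ℓ dx dy` on the right half-plane. -/
noncomputable def weightedMeasure (ℓ : ℕ) : Measure rhp :=
  lebesgue.withDensity (weight ℓ)

theorem lebesgue_abs (ℓ : ℕ) : lebesgue ≪ weightedMeasure ℓ :=
  withDensity_absolutelyContinuous' (measurable_weight ℓ).aemeasurable
    (ae_of_all _ (weight_ne_zero ℓ))

instance : lebesgue.IsOpenPosMeasure :=
  Measure.IsOpenPosMeasure.comap (μ := (volume : Measure ℂ)) (f := ((↑) : rhp → ℂ))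
    isOpen_rhp.isOpenEmbedding_subtypeVal

instance (ℓ : ℕ) : (weightedMeasure ℓ).IsOpenPosMeasure :=
  (lebesgue_abs ℓ).isOpenPosMeasure

/-- The holomorphic functions on the right half-plane that are square integrable with respect to
`(1 / π) x ^ ℓ dx dy`, as a space of functions. -/
def bergmanSubmodule (ℓ : ℕ) : Submodule ℂ (rhp → ℂ) where
  carrier := {h | IsHolo h ∧ MemLp h 2 (weightedMeasure ℓ)}
  zero_mem' := ⟨⟨0, differentiableOn_const 0, fun _ => rfl⟩, MemLp.zero⟩
  add_mem' := by
    rintro h k ⟨⟨F, hF, hE⟩, hh⟩ ⟨⟨G, hG, hE'⟩, hk⟩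
    exact ⟨⟨F + G, hF.add hG, fun z => by simp [hE, hE']⟩, hh.add hk⟩
  smul_mem' := by
    rintro c h ⟨⟨F, hF, hE⟩, hh⟩
    exact ⟨⟨c • F, hF.const_smul c, fun z => by simp [hE]⟩, hh.const_smul c⟩

/-- The weighted Bergman space `A²_ℓ` of the right half-plane. -/
def Bergman (ℓ : ℕ) : Type := bergmanSubmodule ℓ

namespace Bergman

variable {ℓ : ℕ}

noncomputable instance : AddCommGroup (Bergman ℓ) := inferInstanceAs (AddCommGroup (bergmanSubmodule ℓ))

noncomputable instance : Module ℂ (Bergman ℓ) := inferInstanceAs (Module ℂ (bergmanSubmodule ℓ))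

instance : CoeFun (Bergman ℓ) (fun _ => rhp → ℂ) := ⟨fun h => h.1⟩

/-- An element of the Bergman space from a function in it. -/
def mk (h : rhp → ℂ) (hh : h ∈ bergmanSubmodule ℓ) : Bergman ℓ := ⟨h, hh⟩

@[simp] theorem mk_apply (h : rhp → ℂ) (hh : h ∈ bergmanSubmodule ℓ) (z : rhp) :
    mk h hh z = h z := rfl

theorem mem (h : Bergman ℓ) : (h : rhp → ℂ) ∈ bergmanSubmodule ℓ := h.2

theorem isHolo (h : Bergman ℓ) : IsHolo h := h.2.1

theorem memLp (h : Bergman ℓ) : MemLp h 2 (weightedMeasure ℓ) := h.2.2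

@[ext] theorem ext {h k : Bergman ℓ} (hk : ∀ z, h z = k z) : h = k :=
  Subtype.ext (funext hk)

@[simp] theorem add_apply (h k : Bergman ℓ) (z : rhp) : (h + k) z = h z + k z := rfl

@[simp] theorem sub_apply (h k : Bergman ℓ) (z : rhp) : (h - k) z = h z - k z := rfl

@[simp] theorem smul_apply (c : ℂ) (h : Bergman ℓ) (z : rhp) : (c • h) z = c * h z := rfl

/-- The inclusion of the Bergman space in `L²`. -/
noncomputable def toL2 : Bergman ℓ →ₗ[ℂ] Lp ℂ 2 (weightedMeasure ℓ) where
  toFun h := h.memLp.toLp h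
  map_add' h k := MemLp.toLp_add h.memLp k.memLp
  map_smul' c h := MemLp.toLp_const_smul c h.memLp

theorem toL2_injective : Function.Injective (toL2 : Bergman ℓ → _) := by
  intro h k hhk
  have h1 : (h : rhp → ℂ) =ᵐ[weightedMeasure ℓ] k :=
    (MemLp.toLp_eq_toLp_iff h.memLp k.memLp).1 hhk
  exact Subtype.ext (Measure.eq_of_ae_eq h1 h.isHolo.continuous k.isHolo.continuous)

/-- The norm of `A²_ℓ` is the `L²` norm. -/
noncomputable instance : NormedAddCommGroup (Bergman ℓ) :=
  NormedAddCommGroup.induced (Bergman ℓ) (Lp ℂ 2 (weightedMeasure ℓ)) toL2 toL2_injective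

theorem norm_eq (h : Bergman ℓ) : ‖h‖ = ‖toL2 h‖ := rfl

/-- The inner product of `A²_ℓ` is the `L²` inner product. -/
noncomputable instance : InnerProductSpace ℂ (Bergman ℓ) where
  norm_smul_le c h := by rw [norm_eq, norm_eq, map_smul, norm_smul]
  inner h k := inner ℂ (toL2 h) (toL2 k)
  norm_sq_eq_re_inner h := by rw [norm_eq]; exact norm_sq_eq_re_inner _
  conj_inner_symm h k := inner_conj_symm _ _
  add_left h k m := by simp only [map_add, inner_add_left]
  smul_left h k c := by simp only [map_smul, inner_smul_left]

/-- The norm of `A²_ℓ` as an explicit integral. -/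
theorem norm_sq_eq (h : Bergman ℓ) :
    ‖h‖ ^ 2 = 1 / Real.pi * ∫ z : rhp, (z : ℂ).re ^ ℓ * ‖h z‖ ^ 2 ∂lebesgue := by
  have h1 : ‖h‖ ^ 2 = ∫ z, ‖h z‖ ^ 2 ∂weightedMeasure ℓ := by
    have h2 : ‖h‖ ^ 2 = (inner ℂ (toL2 h) (toL2 h)).re := by
      rw [norm_eq]; exact norm_sq_eq_re_inner (𝕜 := ℂ) _
    rw [h2, L2.inner_def, ← RCLike.re_eq_complex_re, ← integral_re (L2.integrable_inner _ _)]
    refine integral_congr_ae ?_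
    filter_upwards [h.memLp.coeFn_toLp] with z hz
    have : (toL2 h : rhp → ℂ) z = h z := hz
    rw [this]
    exact (norm_sq_eq_re_inner (𝕜 := ℂ) _).symm
  rw [h1, weightedMeasure, integral_withDensity_eq_integral_toReal_smul (measurable_weight ℓ)
    (ae_of_all _ fun z => ENNReal.ofReal_lt_top), ← integral_const_mul]
  refine integral_congr_ae (ae_of_all _ fun z => ?_)
  have : 0 < (z : ℂ).re := z.2
  simp only [weight, smul_eq_mul]
  rw [ENNReal.toReal_ofReal (by positivity)]
  ring

theorem circle_bound {F : ℂ → ℂ} {w : ℂ} {r : ℝ} (hr : 0 < r)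
    (hF : DifferentiableOn ℂ F rhp) (hsub : Metric.closedBall w r ⊆ rhp) :
    ENNReal.ofReal (2 * Real.pi) * ‖F w‖ₑ ^ 2 ≤
      ∫⁻ θ in Set.Ioo (-Real.pi) Real.pi, ‖F (w + Complex.polarCoord.symm (r, θ))‖ₑ ^ 2 := by
  have h1 : Real.circleAverage (fun z => F z ^ 2) w r = F w ^ 2 := by
    refine DiffContOnCl.circleAverage (f := fun z => F z ^ 2) ?_
    rw [abs_of_pos hr]
    refine DifferentiableOn.diffContOnCl ?_
    rw [closure_ball _ hr.ne']
    exact (hF.mono hsub).pow 2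
  have h2 : ∫ θ in (-Real.pi)..Real.pi, F (circleMap w r θ) ^ 2
      = (2 * Real.pi : ℝ) • F w ^ 2 := by
    rw [← h1, Real.circleAverage_eq_integral_add (-Real.pi),
      intervalIntegral.integral_comp_add_right (fun θ => F (circleMap w r θ) ^ 2),
      smul_smul, mul_inv_cancel₀ (by positivity), one_smul]
    congr 1 <;> ring
  have h3 : ENNReal.ofReal (2 * Real.pi) * ‖F w‖ₑ ^ 2
      = ‖∫ θ in (-Real.pi)..Real.pi, F (circleMap w r θ) ^ 2‖ₑ := by
    rw [h2, enorm_smul, enorm_pow, Real.enorm_of_nonneg (by positivity)]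
  rw [h3, intervalIntegral.integral_of_le (by linarith [Real.pi_pos]), integral_Ioc_eq_integral_Ioo]
  refine (enorm_integral_le_lintegral_enorm _).trans (le_of_eq ?_)
  refine lintegral_congr fun θ => ?_
  rw [enorm_pow]
  congr 3
  simp [circleMap, Complex.exp_mul_I]

theorem disc_bound {F : ℂ → ℂ} {w : ℂ} {R : ℝ}
    (hF : DifferentiableOn ℂ F rhp) (hsub : Metric.ball w R ⊆ rhp) :
    (∫⁻ r in Set.Ioo 0 R, ENNReal.ofReal r) * (ENNReal.ofReal (2 * Real.pi) * ‖F w‖ₑ ^ 2) ≤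
      ∫⁻ z in Metric.ball w R, ‖F z‖ₑ ^ 2 := by
  set G : ℂ → ENNReal := (Metric.ball w R).indicator (fun z => ‖F z‖ₑ ^ 2) with hG
  have hGm : Measurable G := by
    have h1 : ContinuousOn (fun z => ‖F z‖ₑ ^ 2) (Metric.ball w R) :=
      (ENNReal.continuous_pow 2).comp_continuousOn (hF.continuousOn.mono hsub).enorm
    classical
    have h2 := h1.measurable_piecewise (g := fun _ => (0 : ENNReal)) continuousOn_const
      Metric.isOpen_ball.measurableSet
    rwa [show (fun _ : ℂ => (0 : ENNReal)) = 0 from rfl, Set.piecewise_eq_indicator] at h2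
  rw [← lintegral_indicator Metric.isOpen_ball.measurableSet, ← hG,
    ← lintegral_add_left_eq_self G w, ← Complex.lintegral_comp_polarCoord_symm]
  have hpm : Measurable fun p : ℝ × ℝ => Complex.polarCoord.symm p := by
    simp only [Complex.polarCoord_symm_apply]
    fun_prop
  have ht : polarCoord.target = Set.Ioi (0 : ℝ) ×ˢ Set.Ioo (-Real.pi) Real.pi := rfl
  rw [ht, Measure.volume_eq_prod, ← Measure.prod_restrict, lintegral_prod]
  swap
  · simp only [smul_eq_mul]
    exact ((ENNReal.measurable_ofReal.comp measurable_fst).mul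
      (hGm.comp (hpm.const_add w))).aemeasurable
  rw [← lintegral_mul_const _ ENNReal.measurable_ofReal]
  refine le_trans ?_ (lintegral_mono_set (fun r hr => hr.1 : Set.Ioo 0 R ⊆ Set.Ioi 0))
  refine setLIntegral_mono' measurableSet_Ioo fun r hr => ?_
  simp only [smul_eq_mul]
  rw [lintegral_const_mul' _ _ ENNReal.ofReal_ne_top]
  gcongr
  refine (circle_bound hr.1 hF
    ((Metric.closedBall_subset_ball hr.2).trans hsub)).trans (le_of_eq ?_)
  refine lintegral_congr fun θ => ?_
  rw [hG, Set.indicator_of_mem]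
  simp only [Metric.mem_ball, dist_self_add_left, Complex.norm_polarCoord_symm]
  rw [abs_of_pos hr.1]
  exact hr.2

theorem enorm_sq_eq (h : Bergman ℓ) : ‖h‖ₑ ^ 2 = ∫⁻ z, weight ℓ z * ‖h z‖ₑ ^ 2 ∂lebesgue := by
  have h1 : ‖h‖ₑ = eLpNorm h 2 (weightedMeasure ℓ) := by
    rw [← ofReal_norm, norm_eq]
    exact (ofReal_norm _).trans (Lp.enorm_toLp h.memLp)
  have hm : Measurable fun z => ‖h z‖ₑ ^ 2 := (h.isHolo.continuous.enorm.measurable).pow_const 2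
  rw [h1, eLpNorm_eq_lintegral_rpow_enorm_toReal (by simp) (by simp), ← ENNReal.rpow_two,
    ← ENNReal.rpow_mul]
  simp only [ENNReal.toReal_ofNat, ENNReal.rpow_two]
  norm_num
  rw [weightedMeasure, lintegral_withDensity_eq_lintegral_mul _ (measurable_weight ℓ) hm]
  rfl

/-- Point evaluations are bounded, locally uniformly. -/
theorem exists_bound (w₀ : rhp) : ∃ r > 0, ∃ C : ℝ, ∀ h : Bergman ℓ, ∀ w : rhp,
    dist w w₀ < r → ‖h w‖ ≤ C * ‖h‖ := by
  have hw₀ : 0 < (w₀ : ℂ).re := w₀.2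
  set R : ℝ := (w₀ : ℂ).re / 3 with hRdef
  have hR : 0 < R := by positivity
  set A : ENNReal := ∫⁻ r in Set.Ioo 0 R, ENNReal.ofReal r with hA
  have hA0 : A ≠ 0 := by
    rw [hA, Ne, setLIntegral_eq_zero_iff measurableSet_Ioo ENNReal.measurable_ofReal]
    intro h0
    have h1 : ∀ᵐ r : ℝ, r ∉ Set.Ioo 0 R := by
      filter_upwards [h0] with r hr hr'
      have := hr hr'
      simp only [ENNReal.ofReal_eq_zero] at this
      exact absurd hr'.1 (not_lt.2 this)
    have h2 : volume (Set.Ioo 0 R) = 0 := by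
      rw [measure_eq_zero_iff_ae_notMem]; exact h1
    rw [Real.volume_Ioo] at h2
    simp only [sub_zero, ENNReal.ofReal_eq_zero] at h2
    linarith
  set B : ENNReal := A * ENNReal.ofReal (2 * Real.pi) * ENNReal.ofReal (R ^ ℓ / Real.pi) with hB
  have hB0 : B ≠ 0 := by
    rw [hB]
    refine mul_ne_zero (mul_ne_zero hA0 ?_) ?_ <;>
    · rw [Ne, ENNReal.ofReal_eq_zero, not_le]; positivity
  refine ⟨R, hR, Real.sqrt (B⁻¹).toReal, fun h w hw => ?_⟩
  obtain ⟨F, hF, hE⟩ := h.isHolo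
  have hre : ∀ z ∈ Metric.ball (w : ℂ) R, R ≤ z.re := by
    intro z hz
    have h1 : |(z - w : ℂ).re| < R :=
      (Complex.abs_re_le_norm _).trans_lt (by rwa [← dist_eq_norm])
    have h2 : |(w - w₀ : ℂ).re| < R :=
      (Complex.abs_re_le_norm _).trans_lt (by rw [← dist_eq_norm]; exact hw)
    rw [Complex.sub_re, abs_lt] at h1 h2
    have : (w₀ : ℂ).re = 3 * R := by rw [hRdef]; ring
    linarith [h1.1, h2.1]
  have hsub : Metric.ball (w : ℂ) R ⊆ rhp := fun z hz => hR.trans_le (hre z hz)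
  have hkey : B * ‖h w‖ₑ ^ 2 ≤ ‖h‖ₑ ^ 2 := by
    have h2 : ‖h‖ₑ ^ 2 =
        ∫⁻ z in rhp, ENNReal.ofReal (z.re ^ ℓ / Real.pi) * ‖F z‖ₑ ^ 2 := by
      rw [enorm_sq_eq, ← lintegral_subtype_comap isOpen_rhp.measurableSet]
      simp only [hE]
      rfl
    rw [h2]
    refine le_trans ?_ (lintegral_mono_set hsub)
    calc B * ‖h w‖ₑ ^ 2 = ENNReal.ofReal (R ^ ℓ / Real.pi) *
          (A * (ENNReal.ofReal (2 * Real.pi) * ‖F w‖ₑ ^ 2)) := by rw [hB, hE]; ring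
      _ ≤ ENNReal.ofReal (R ^ ℓ / Real.pi) * ∫⁻ z in Metric.ball (w : ℂ) R, ‖F z‖ₑ ^ 2 := by
          gcongr
          exact disc_bound hF hsub
      _ = ∫⁻ z in Metric.ball (w : ℂ) R, ENNReal.ofReal (R ^ ℓ / Real.pi) * ‖F z‖ₑ ^ 2 :=
          (lintegral_const_mul' _ _ ENNReal.ofReal_ne_top).symm
      _ ≤ _ := by
          refine setLIntegral_mono' Metric.isOpen_ball.measurableSet fun z hz => ?_
          have := hre z hz
          gcongr
  have h3 : ‖h w‖ₑ ^ 2 ≤ B⁻¹ * ‖h‖ₑ ^ 2 := by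
    rw [mul_comm, ← div_eq_mul_inv, ENNReal.le_div_iff_mul_le (Or.inl hB0)
      (Or.inr (by finiteness)), mul_comm]
    exact hkey
  have h4 : ‖h w‖ ^ 2 ≤ (B⁻¹).toReal * ‖h‖ ^ 2 := by
    have := ENNReal.toReal_mono (ENNReal.mul_ne_top (ENNReal.inv_ne_top.2 hB0) (by finiteness)) h3
    simpa [ENNReal.toReal_mul, ENNReal.toReal_pow] using this
  refine abs_le_of_sq_le_sq' ?_ (by positivity) |>.2
  rw [mul_pow, Real.sq_sqrt ENNReal.toReal_nonneg]
  exact h4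

instance : CompleteSpace (Bergman ℓ) := by
  refine Metric.complete_of_cauchySeq_tendsto fun u hu => ?_
  have hJ : ∀ h k : Bergman ℓ, dist (toL2 h) (toL2 k) = dist h k := fun h k => rfl
  have hu' : CauchySeq fun n => toL2 (u n) := by
    rw [Metric.cauchySeq_iff] at hu ⊢
    simpa only [hJ] using hu
  obtain ⟨G, hG⟩ := cauchySeq_tendsto_of_complete hu'
  have hpt : ∀ z : rhp, ∃ c, Tendsto (fun n => u n z) atTop (𝓝 c) := by
    intro z
    refine cauchySeq_tendsto_of_complete ?_
    obtain ⟨r, hr, C, hC⟩ := exists_bound (ℓ := ℓ) z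
    have hL : LipschitzWith C.toNNReal (fun h : Bergman ℓ => h z) := by
      refine LipschitzWith.of_dist_le_mul fun h k => ?_
      rw [dist_eq_norm, dist_eq_norm, ← sub_apply]
      refine (hC (h - k) z (by simpa using hr)).trans ?_
      gcongr
      exact Real.le_coe_toNNReal C
    exact hu.map hL.uniformContinuous
  choose H hH using hpt
  have hext : ∀ (k : rhp → ℂ) (z : rhp), Function.extend Subtype.val k 0 (z : ℂ) = k z :=
    fun k z => Subtype.val_injective.extend_apply k 0 z
  have hlu : TendstoLocallyUniformlyOn (fun n => Function.extend Subtype.val (u n : rhp → ℂ) 0)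
      (Function.extend Subtype.val H 0) atTop rhp := by
    rw [Metric.tendstoLocallyUniformlyOn_iff]
    intro ε hε z hz
    obtain ⟨r, hr, C, hC⟩ := exists_bound (ℓ := ℓ) ⟨z, hz⟩
    refine ⟨Metric.ball z r ∩ rhp, inter_mem (mem_nhdsWithin_of_mem_nhds (Metric.ball_mem_nhds z hr))
      self_mem_nhdsWithin, ?_⟩
    have hC0 : 0 < |C| + 1 := by positivity
    obtain ⟨N, hN⟩ := Metric.cauchySeq_iff.1 hu (ε / 2 / (|C| + 1)) (by positivity)
    filter_upwards [eventually_ge_atTop N] with n hn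
    rintro y ⟨hy, hy'⟩
    have e1 := hext H ⟨y, hy'⟩
    have e2 := hext (u n) ⟨y, hy'⟩
    simp only at e1 e2
    rw [e1, e2]
    have hle : dist (H ⟨y, hy'⟩) (u n ⟨y, hy'⟩) ≤ ε / 2 := by
      refine le_of_tendsto ((hH ⟨y, hy'⟩).dist tendsto_const_nhds) ?_
      filter_upwards [eventually_ge_atTop N] with m hm
      rw [dist_eq_norm, ← sub_apply]
      refine (hC (u m - u n) ⟨y, hy'⟩ hy).trans ?_
      have h3 := (hN m hm n hn).le
      rw [dist_eq_norm] at h3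
      calc C * ‖u m - u n‖ ≤ (|C| + 1) * ‖u m - u n‖ := by
            gcongr; linarith [le_abs_self C]
        _ ≤ (|C| + 1) * (ε / 2 / (|C| + 1)) := by gcongr
        _ = ε / 2 := by field_simp
    linarith
  have hholo : IsHolo H := by
    refine ⟨_, hlu.differentiableOn (Eventually.of_forall fun n => ?_) isOpen_rhp,
      fun z => (hext H z).symm⟩
    obtain ⟨F, hF, hE⟩ := (u n).isHolo
    refine hF.congr fun z hz => ?_
    exact (hext (u n) ⟨z, hz⟩).trans (hE ⟨z, hz⟩)
  obtain ⟨ns, hns, hae⟩ := (tendstoInMeasure_of_tendsto_Lp hG).exists_seq_tendsto_ae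
  have hHG : (G : rhp → ℂ) =ᵐ[weightedMeasure ℓ] H := by
    have h4 : ∀ᵐ z ∂weightedMeasure ℓ, ∀ n, (toL2 (u n) : rhp → ℂ) z = u n z :=
      ae_all_iff.2 fun n => (u n).memLp.coeFn_toLp
    filter_upwards [hae, h4] with z hz hz4
    refine tendsto_nhds_unique hz ?_
    simp only [hz4]
    exact (hH z).comp hns.tendsto_atTop
  have hmem : MemLp H 2 (weightedMeasure ℓ) := (Lp.memLp G).ae_eq hHG
  refine ⟨mk H ⟨hholo, hmem⟩, ?_⟩
  have h5 : toL2 (mk H ⟨hholo, hmem⟩ : Bergman ℓ) = G := by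
    refine Lp.ext ?_
    exact hmem.coeFn_toLp.trans hHG.symm
  rw [tendsto_iff_dist_tendsto_zero] at hG ⊢
  simpa only [← h5, hJ] using hG

end Bergman

/-- The reflection `z ↦ conj z + i a` of the right half-plane. -/
noncomputable def reflect (a : ℝ) (z : rhp) : rhp :=
  ⟨conj (z : ℂ) + Complex.I * a, by simpa [rhp] using z.2⟩

theorem reflect_reflect (a : ℝ) (z : rhp) : reflect a (reflect a z) = z := by
  apply Subtype.ext
  simp [reflect]

theorem measurePreserving_reflect (ℓ : ℕ) (a : ℝ) :
    MeasurePreserving (reflect a) (weightedMeasure ℓ) (weightedMeasure ℓ) := by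
  have hm : Measurable (reflect a) := by
    apply Measurable.subtype_mk
    fun_prop
  have hv : MeasurePreserving (reflect a) lebesgue lebesgue := by
    refine ⟨hm, ?_⟩
    have hσ : MeasurePreserving (fun z : ℂ => conj z + Complex.I * a) volume volume :=
      (measurePreserving_add_right volume (Complex.I * a)).comp
        Complex.conjLIE.measurePreserving
    ext s hs
    rw [Measure.map_apply hm hs, lebesgue, comap_subtype_coe_apply isOpen_rhp.measurableSet,
      comap_subtype_coe_apply isOpen_rhp.measurableSet,
      ← hσ.measure_preimage (isOpen_rhp.measurableSet.subtype_image hs).nullMeasurableSet]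
    congr 1
    ext z
    constructor
    · rintro ⟨w, hw, rfl⟩
      exact ⟨reflect a w, hw, rfl⟩
    · rintro ⟨w, hw, hwz⟩
      refine ⟨reflect a w, by simpa [reflect_reflect] using hw, ?_⟩
      simp [reflect, hwz]
  have hw : ∀ z, weight ℓ (reflect a z) = weight ℓ z := fun z => by simp [weight, reflect]
  refine ⟨hm, ?_⟩
  ext s hs
  rw [Measure.map_apply hm hs, weightedMeasure, withDensity_apply _ (hm hs),
    withDensity_apply _ hs, ← hv.setLIntegral_comp_preimage hs (measurable_weight ℓ)]
  simp only [hw]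

/-- The conjugate-linear operator `C_a h (z) = conj (h (conj z + i a))` on `A²_ℓ`. -/
noncomputable def conjOp (ℓ : ℕ) (a : ℝ) : Bergman ℓ →ₗ⋆[ℂ] Bergman ℓ where
  toFun h := Bergman.mk (fun z => conj (h (reflect a z))) (by
    refine ⟨?_, (h.memLp.comp_measurePreserving (measurePreserving_reflect ℓ a)).star⟩
    obtain ⟨F, hF, hE⟩ := h.isHolo
    refine ⟨fun z => conj (F (conj z + Complex.I * a)), fun z hz => ?_, fun z => ?_⟩
    · have hz' : conj z + Complex.I * a ∈ rhp := (reflect a ⟨z, hz⟩).2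
      have h1 : DifferentiableAt ℂ (fun y => F (y + Complex.I * a)) (conj z) :=
        DifferentiableAt.comp (conj z) (f := fun y => y + Complex.I * a) (g := F)
          (hF.differentiableAt (isOpen_rhp.mem_nhds hz')) (by fun_prop)
      have h2 := h1.star_star
      rw [show star (conj z) = z from Complex.conj_conj z] at h2
      exact h2.differentiableWithinAt
    · simp [hE, reflect])
  map_add' h k := Bergman.ext fun z => map_add conj (h (reflect a z)) (k (reflect a z))
  map_smul' c h := Bergman.ext fun z => map_mul conj c (h (reflect a z))

@[simp] theorem conjOp_apply (ℓ : ℕ) (a : ℝ) (h : Bergman ℓ) (z : rhp) :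
    conjOp ℓ a h z = conj (h (reflect a z)) := rfl

/-- The maximal weighted composition operator: its domain consists of the `h` in `A²_ℓ` for which
`f · (h ∘ g)` lies in `A²_ℓ`, and it maps such an `h` to `f · (h ∘ g)`. -/
noncomputable def maxWCO (ℓ : ℕ) (f : rhp → ℂ) (g : rhp → rhp) : Bergman ℓ →ₗ.[ℂ] Bergman ℓ where
  domain :=
    { carrier := {h | (fun z => f z * h (g z)) ∈ bergmanSubmodule ℓ}
      zero_mem' := by
        have : (fun z => f z * (0 : Bergman ℓ) (g z)) = 0 := by ext z; exact mul_zero _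
        rw [Set.mem_ofPred_eq, this]
        exact zero_mem _
      add_mem' := by
        intro h k hh hk
        have := (bergmanSubmodule ℓ).add_mem hh hk
        rw [Set.mem_ofPred_eq]
        convert this using 1
        ext z
        simp [mul_add]
      smul_mem' := by
        intro c h hh
        have := (bergmanSubmodule ℓ).smul_mem c hh
        rw [Set.mem_ofPred_eq]
        convert this using 1
        ext z
        simp [mul_left_comm] }
  toFun :=
    { toFun := fun h => Bergman.mk (fun z => f z * (h : Bergman ℓ) (g z)) h.2
      map_add' := fun h k => by ext z; simp [mul_add]
      map_smul' := fun c h => by ext z; simp [mul_left_comm] }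

section Operators

variable {E : Type*} [NormedAddCommGroup E] [InnerProductSpace ℂ E]

/-- The operator `C T C` for a conjugate-linear map `C` and an unbounded operator `T`; its domain
is `{h | C h ∈ dom T}`. -/
def sandwich (C : E →ₗ⋆[ℂ] E) (T : E →ₗ.[ℂ] E) : E →ₗ.[ℂ] E where
  domain := T.domain.comap C
  toFun :=
    { toFun := fun h => C (T ⟨C h, h.2⟩)
      map_add' := fun h k => by
        rw [← map_add, ← LinearPMap.map_add]
        congr 2
        exact Subtype.ext (map_add C _ _)
      map_smul' := fun c h => by
        have : (⟨C ((c • h : T.domain.comap C) : E), (c • h).2⟩ : T.domain)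
            = conj c • ⟨C h, h.2⟩ := Subtype.ext (map_smulₛₗ C _ _)
        rw [this, LinearPMap.map_smul, map_smulₛₗ]
        simp }

/-- `T` is `C`-selfadjoint: it is densely defined, so that it has an adjoint `T*`, and
`C T* C = T`, with equality of domains. -/
def IsCSelfAdjoint [CompleteSpace E] (C : E →ₗ⋆[ℂ] E) (T : E →ₗ.[ℂ] E) : Prop :=
  Dense (T.domain : Set E) ∧ sandwich C T.adjoint = T

/-- `T` is everywhere defined and bounded. -/
def IsBoundedOperator (T : E →ₗ.[ℂ] E) : Prop :=
  T.domain = ⊤ ∧ ∃ L > 0, ∀ h : T.domain, ‖T h‖ ≤ L * ‖(h : E)‖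

end Operators

/-- First case: `g` is a constant `μ` and `f(w) = δ / (w + μ - i a) ^ (ℓ + 2)`. -/
def SymbolCase1 (ℓ : ℕ) (a : ℝ) (f : rhp → ℂ) (g : rhp → rhp) : Prop :=
  ∃ μ δ : ℂ, 0 < μ.re ∧ ∀ w : rhp,
    (g w : ℂ) = μ ∧ f w = δ / ((w : ℂ) + μ - Complex.I * a) ^ (ℓ + 2)

/-- Second case: `g(w) = w + γ` with `Re γ ≥ 0` and `f` is a constant `λ`. -/
def SymbolCase2 (f : rhp → ℂ) (g : rhp → rhp) : Prop :=
  ∃ γ lam : ℂ, 0 ≤ γ.re ∧ ∀ w : rhp, (g w : ℂ) = w + γ ∧ f w = lam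

/-- Third case: `g(w) = - β / α - 2 / (α (w - i a) - β)` and
`f(w) = δ / (α (w - i a) - β) ^ (ℓ + 2)`, with conditions on `α` and `β`. -/
def SymbolCase3 (ℓ : ℕ) (a : ℝ) (f : rhp → ℂ) (g : rhp → rhp) : Prop :=
  ∃ α β δ : ℂ, α ≠ 0 ∧
    (((β / α).re = 0 ∧ (1 / α).im = 0 ∧ (1 / α).re < 0) ∨
      ((β / α).re < 0 ∧ (1 / α).re + 1 / ‖α‖ ≤ (β / α).re ^ 2)) ∧
    ∀ w : rhp, (g w : ℂ) = -(β / α) - 2 / (α * ((w : ℂ) - Complex.I * a) - β) ∧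
      f w = δ / (α * ((w : ℂ) - Complex.I * a) - β) ^ (ℓ + 2)

end HalfPlane

/-! Everything is tested on the reproducing kernels `K_w(z) = 2^ℓ (ℓ+1) / (z + conj w)^(ℓ+2)`, for
which `⟨K_w, h⟩ = h w` (`Bergman.inner_kernel`). A densely defined restriction `W` of the maximal
operator satisfies `W* K_w = conj (f w) K_{g w}`, and `C_a K_w = K_{conj w + ia}`. Evaluating `C_a
W* C_a = W` on kernels therefore yields the functional equation `f(z) (z + g(w) - ia)^(ℓ+2) = f(w)
(w + g(z) - ia)^(ℓ+2)`, which is `SymbolSymmetric`.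

To solve it (`SymbolSymmetric.classification`), note that `f` vanishes everywhere or nowhere. In the
latter case the ratio `T(z,w)` of the two bases satisfies `T^(ℓ+2) = f(w) / f(z)`, so `T` is a
multiplicative cocycle up to roots of unity, and connectedness of the half-plane removes the roots
of unity. Eliminating `g` from the cocycle identity shows that `T(·, w₀)` is affine. Hence `g` is a
constant, a translation or a Möbius map, and `f` is the matching power. The inequalities on the
parameters say that `g` preserves the half-plane.

Conversely, all these symbols solve the equation and give bounded operators: rank one if `g` is
constant, and otherwise by Schwarz-Pick together with `|f|² ≤ C |g'|^(ℓ+2)`. Boundedness and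
symmetry on kernels make the maximal operator `M` selfadjoint with respect to `C_a`. Finally, if `W
≤ M` is also selfadjoint, then `M = C M* C ≤ C W* C = W`, so the functional equation alone forces
maximality and boundedness. -/

namespace HalfPlane

/-! ### Change of variables along injective holomorphic maps, and integrals against the weight. -/

/-- The differential of a holomorphic function, as a real linear map, has determinant `|f'| ^ 2`. -/
theorem det_smul_one (c : ℂ) : (c • (1 : ℂ →L[ℝ] ℂ)).det = ‖c‖ ^ 2 := by
  have h1 : ((c • (1 : ℂ →L[ℝ] ℂ) : ℂ →L[ℝ] ℂ) : ℂ →ₗ[ℝ] ℂ) = LinearMap.mul ℝ ℂ c := by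
    ext
    simp
  rw [ContinuousLinearMap.det, h1]
  have h2 : LinearMap.det (LinearMap.mul ℝ ℂ c) = Algebra.norm ℝ c := rfl
  rw [h2, Algebra.norm_complex_apply, Complex.normSq_eq_norm_sq]

section ChangeOfVariables

variable {E : Type*} [NormedAddCommGroup E] [NormedSpace ℝ E] {s : Set ℂ} {φ φ' : ℂ → ℂ}

theorem lintegral_image_holo (hs : MeasurableSet s) (hφ : ∀ z ∈ s, HasDerivAt φ (φ' z) z)
    (hinj : Set.InjOn φ s) (u : ℂ → ENNReal) :
    ∫⁻ z in φ '' s, u z = ∫⁻ z in s, ENNReal.ofReal (‖φ' z‖ ^ 2) * u (φ z) := by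
  rw [lintegral_image_eq_lintegral_abs_det_fderiv_mul volume hs
    (fun z hz => (hφ z hz).complexToReal_fderiv.hasFDerivWithinAt) hinj]
  simp only [det_smul_one, abs_pow, abs_norm]

theorem integral_image_holo (hs : MeasurableSet s) (hφ : ∀ z ∈ s, HasDerivAt φ (φ' z) z)
    (hinj : Set.InjOn φ s) (u : ℂ → E) :
    ∫ z in φ '' s, u z = ∫ z in s, ‖φ' z‖ ^ 2 • u (φ z) := by
  rw [integral_image_eq_integral_abs_det_fderiv_smul volume hs
    (fun z hz => (hφ z hz).complexToReal_fderiv.hasFDerivWithinAt) hinj]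
  simp only [det_smul_one, abs_pow, abs_norm]

theorem integrableOn_image_holo (hs : MeasurableSet s) (hφ : ∀ z ∈ s, HasDerivAt φ (φ' z) z)
    (hinj : Set.InjOn φ s) (u : ℂ → E) :
    IntegrableOn u (φ '' s) ↔ IntegrableOn (fun z => ‖φ' z‖ ^ 2 • u (φ z)) s := by
  rw [integrableOn_image_iff_integrableOn_abs_det_fderiv_smul volume hs
    (fun z hz => (hφ z hz).complexToReal_fderiv.hasFDerivWithinAt) hinj]
  simp only [det_smul_one, abs_pow, abs_norm]

end ChangeOfVariables

section WeightedMeasure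

variable {E : Type*} [NormedAddCommGroup E] [NormedSpace ℝ E] {ℓ : ℕ}

theorem toReal_weight (z : rhp) : (weight ℓ z).toReal = (z : ℂ).re ^ ℓ / Real.pi := by
  have : 0 < (z : ℂ).re := z.2
  rw [weight, ENNReal.toReal_ofReal (by positivity)]

theorem integral_weightedMeasure (F : ℂ → E) :
    ∫ z : rhp, F z ∂weightedMeasure ℓ = ∫ z in rhp, (z.re ^ ℓ / Real.pi) • F z := by
  rw [weightedMeasure, integral_withDensity_eq_integral_toReal_smul (measurable_weight ℓ)
    (ae_of_all _ fun z => ENNReal.ofReal_lt_top)]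
  simp only [toReal_weight]
  exact integral_subtype_comap isOpen_rhp.measurableSet
    (fun z : ℂ => (z.re ^ ℓ / Real.pi) • F z)

theorem integrable_weightedMeasure (F : ℂ → E) :
    Integrable (fun z : rhp => F z) (weightedMeasure ℓ) ↔
      IntegrableOn (fun z => (z.re ^ ℓ / Real.pi) • F z) rhp := by
  rw [weightedMeasure, integrable_withDensity_iff_integrable_smul' (measurable_weight ℓ)
    (ae_of_all _ fun z => ENNReal.ofReal_lt_top),
    integrableOn_iff_comap_subtypeVal isOpen_rhp.measurableSet]
  simp only [toReal_weight]
  rfl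

theorem lintegral_weightedMeasure {F : ℂ → ENNReal} (hF : Measurable fun z : rhp => F z) :
    ∫⁻ z : rhp, F z ∂weightedMeasure ℓ =
      ∫⁻ z in rhp, ENNReal.ofReal (z.re ^ ℓ / Real.pi) * F z := by
  rw [weightedMeasure, lintegral_withDensity_eq_lintegral_mul _ (measurable_weight ℓ) hF]
  exact lintegral_subtype_comap isOpen_rhp.measurableSet
    (fun z : ℂ => ENNReal.ofReal (z.re ^ ℓ / Real.pi) * F z)

end WeightedMeasure

/-! ### The weighted mean value property on the unit disc. -/

theorem integral_circle {H : ℂ → ℂ} (hH : DifferentiableOn ℂ H (Metric.ball 0 1)) {r : ℝ}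
    (hr : r ∈ Set.Ioo (0 : ℝ) 1) :
    ∫ θ in Set.Ioo (-Real.pi) Real.pi, H (Complex.polarCoord.symm (r, θ)) =
      (2 * Real.pi : ℝ) • H 0 := by
  have h1 : Real.circleAverage H 0 r = H 0 := by
    refine DiffContOnCl.circleAverage ?_
    rw [abs_of_pos hr.1]
    refine DifferentiableOn.diffContOnCl ?_
    rw [closure_ball _ hr.1.ne']
    exact hH.mono (Metric.closedBall_subset_ball hr.2)
  rw [← h1, Real.circleAverage_eq_integral_add (-Real.pi),
    intervalIntegral.integral_comp_add_right (fun θ => H (circleMap 0 r θ)),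
    smul_smul, mul_inv_cancel₀ (by positivity), one_smul,
    show 0 + -Real.pi = -Real.pi by ring, show 2 * Real.pi + -Real.pi = Real.pi by ring,
    intervalIntegral.integral_of_le (by linarith [Real.pi_pos]), integral_Ioc_eq_integral_Ioo]
  refine integral_congr_ae (ae_of_all _ fun θ => ?_)
  simp [circleMap, Complex.exp_mul_I]

/-- Supplies the hypothesis of Fubini in `integral_disc`; the factor `p.1` is the Jacobian of polar
coordinates. -/
theorem integrableOn_polar {G : ℂ → ℂ} (hG : Integrable G) :
    IntegrableOn (fun p : ℝ × ℝ => p.1 • G (Complex.polarCoord.symm p)) polarCoord.target := by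
  have h1 : Integrable (fun p : ℝ × ℝ => G (Complex.measurableEquivRealProd.symm p)) :=
    (Complex.volume_preserving_equiv_real_prod.symm).integrable_comp_emb
      Complex.measurableEquivRealProd.symm.measurableEmbedding |>.2 hG
  have h2 := (integrableOn_image_iff_integrableOn_abs_det_fderiv_smul volume
    polarCoord.open_target.measurableSet
    (fun p _ => (hasFDerivAt_polarCoord_symm p).hasFDerivWithinAt) polarCoord.symm.injOn
    (fun p : ℝ × ℝ => G (Complex.measurableEquivRealProd.symm p))).1 h1.integrableOn
  refine h2.congr_fun (fun p hp => ?_) polarCoord.open_target.measurableSet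
  have hp' : 0 < p.1 := hp.1
  simp only [det_fderivPolarCoordSymm, abs_of_pos hp']
  rw [Complex.measurableEquivRealProd_symm_polarCoord_symm_apply]

theorem integral_radial (ℓ : ℕ) :
    ∫ r : ℝ in Set.Ioo 0 1, r * (1 - r ^ 2) ^ ℓ = (1 / (2 * (ℓ + 1)) : ℝ) := by
  rw [← integral_Ioc_eq_integral_Ioo, ← intervalIntegral.integral_of_le zero_le_one]
  have hd : ∀ r ∈ Set.uIcc (0 : ℝ) 1,
      HasDerivAt (fun r : ℝ => -((1 - r ^ 2) ^ (ℓ + 1)) / (2 * ((ℓ : ℝ) + 1))) (r * (1 - r ^ 2) ^ ℓ) r := by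
    intro r _
    have h1 : HasDerivAt (fun r : ℝ => 1 - r ^ 2) (-(2 * r)) r := by
      simpa using (hasDerivAt_pow 2 r).const_sub 1
    have h2 := ((h1.pow (ℓ + 1)).neg).div_const (2 * ((ℓ : ℝ) + 1))
    refine h2.congr_deriv ?_
    simp only [Nat.add_sub_cancel, Nat.cast_add, Nat.cast_one]
    rw [div_eq_iff (by positivity)]
    ring
  rw [intervalIntegral.integral_eq_sub_of_hasDerivAt hd
    (Continuous.intervalIntegrable (by fun_prop) _ _)]
  simp [neg_div]

/-- The weighted mean value property on the unit disc. -/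
theorem integral_disc {H : ℂ → ℂ} (hH : DifferentiableOn ℂ H (Metric.ball 0 1)) (ℓ : ℕ)
    (hi : IntegrableOn (fun z => (1 - ‖z‖ ^ 2) ^ ℓ • H z) (Metric.ball 0 1)) :
    ∫ z in Metric.ball 0 1, (1 - ‖z‖ ^ 2) ^ ℓ • H z = (Real.pi / (ℓ + 1) : ℝ) • H 0 := by
  set G : ℂ → ℂ := (Metric.ball 0 1).indicator (fun z => (1 - ‖z‖ ^ 2) ^ ℓ • H z) with hG
  have hGi : Integrable G := (integrable_indicator_iff Metric.isOpen_ball.measurableSet).2 hi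
  have ht : polarCoord.target = Set.Ioi (0 : ℝ) ×ˢ Set.Ioo (-Real.pi) Real.pi := rfl
  have hpi := integrableOn_polar hGi
  rw [← integral_indicator Metric.isOpen_ball.measurableSet, ← hG,
    ← Complex.integral_comp_polarCoord_symm]
  rw [ht, Measure.volume_eq_prod] at hpi ⊢
  rw [setIntegral_prod _ hpi]
  have hin : ∀ r ∈ Set.Ioi (0 : ℝ), ∫ θ in Set.Ioo (-Real.pi) Real.pi,
      r • G (Complex.polarCoord.symm (r, θ)) =
      (Set.Ioo (0 : ℝ) 1).indicator (fun r => (r * (1 - r ^ 2) ^ ℓ) • ((2 * Real.pi : ℝ) • H 0)) r := by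
    intro r hr
    have hr' : 0 < r := hr
    by_cases h1 : r < 1
    · rw [Set.indicator_of_mem (show r ∈ Set.Ioo (0 : ℝ) 1 from ⟨hr, h1⟩), ← integral_circle hH ⟨hr, h1⟩,
        ← integral_smul]
      refine integral_congr_ae (ae_of_all _ fun θ => ?_)
      have hm : Complex.polarCoord.symm (r, θ) ∈ Metric.ball (0 : ℂ) 1 := by
        rw [mem_ball_zero_iff, Complex.norm_polarCoord_symm, abs_of_pos hr']
        exact h1
      simp only [hG]
      rw [Set.indicator_of_mem hm, Complex.norm_polarCoord_symm, sq_abs, smul_smul]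
    · rw [Set.indicator_of_notMem (fun h => h1 h.2)]
      refine integral_eq_zero_of_ae (ae_of_all _ fun θ => ?_)
      have hm : Complex.polarCoord.symm (r, θ) ∉ Metric.ball (0 : ℂ) 1 := by
        rw [mem_ball_zero_iff, Complex.norm_polarCoord_symm, abs_of_pos hr']
        exact h1
      simp only [hG]
      rw [Set.indicator_of_notMem hm, smul_zero]
      rfl
  rw [setIntegral_congr_fun measurableSet_Ioi hin, setIntegral_indicator measurableSet_Ioo,
    Set.inter_eq_self_of_subset_right Set.Ioo_subset_Ioi_self, integral_smul_const, integral_radial,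
    smul_smul]
  congr 1
  have : (ℓ : ℝ) + 1 ≠ 0 := by positivity
  field_simp

/-! ### Conformal maps from the disc to the half-plane. -/

/-- The conformal map of the unit disc onto the right half-plane that sends `0` to `w`. -/
noncomputable def cayley (w ζ : ℂ) : ℂ := (w + conj w * ζ) / (1 - ζ)

section Cayley

variable {w ζ : ℂ}

theorem one_sub_ne_zero (hζ : ζ ∈ Metric.ball (0 : ℂ) 1) : 1 - ζ ≠ 0 := by
  intro h
  rw [← sub_eq_zero.1 h] at hζ
  simp at hζ

theorem cayley_zero (w : ℂ) : cayley w 0 = w := by simp [cayley]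

/-- In the disc coordinate the kernel at `w` becomes a constant multiple of `(1 - ζ)^(ℓ+2)`. -/
theorem cayley_add_conj (w : ℂ) (hζ : ζ ∈ Metric.ball (0 : ℂ) 1) :
    cayley w ζ + conj w = (2 * w.re : ℝ) / (1 - ζ) := by
  have := one_sub_ne_zero hζ
  rw [cayley, ← Complex.add_conj]
  field_simp
  ring

theorem re_cayley (w : ℂ) (hζ : ζ ∈ Metric.ball (0 : ℂ) 1) :
    (cayley w ζ).re = w.re * (1 - ‖ζ‖ ^ 2) / ‖1 - ζ‖ ^ 2 := by
  have h0 := one_sub_ne_zero hζ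
  have h1 : Complex.normSq (1 - ζ) ≠ 0 := by simpa using h0
  rw [cayley, Complex.div_re, ← Complex.normSq_eq_norm_sq, ← Complex.normSq_eq_norm_sq]
  field_simp
  simp [Complex.normSq_apply]
  ring

theorem hasDerivAt_cayley (w : ℂ) (hζ : ζ ∈ Metric.ball (0 : ℂ) 1) :
    HasDerivAt (cayley w) ((2 * w.re : ℝ) / (1 - ζ) ^ 2) ζ := by
  have h0 := one_sub_ne_zero hζ
  have h1 : HasDerivAt (fun ζ : ℂ => w + conj w * ζ) (conj w) ζ := by
    simpa using ((hasDerivAt_id ζ).const_mul (conj w)).const_add w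
  have h2 : HasDerivAt (fun ζ : ℂ => 1 - ζ) (-1) ζ := by
    simpa using (hasDerivAt_id ζ).const_sub 1
  have h3 := h1.div h2 h0
  refine h3.congr_deriv ?_
  rw [← Complex.add_conj]
  ring

theorem injOn_cayley (hw : w ∈ rhp) : Set.InjOn (cayley w) (Metric.ball 0 1) := by
  intro ζ hζ ξ hξ h
  have h1 := cayley_add_conj w hζ
  rw [h, cayley_add_conj w hξ] at h1
  have h2 : ((2 * w.re : ℝ) : ℂ) ≠ 0 := by
    have : 0 < w.re := hw
    exact_mod_cast (by positivity : (2 * w.re) ≠ 0)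
  rw [div_eq_div_iff (one_sub_ne_zero hξ) (one_sub_ne_zero hζ)] at h1
  have h3 := mul_left_cancel₀ h2 h1
  linear_combination -h3

theorem image_cayley (hw : w ∈ rhp) : cayley w '' Metric.ball 0 1 = rhp := by
  have hw' : 0 < w.re := hw
  ext z
  constructor
  · rintro ⟨ζ, hζ, rfl⟩
    have h0 := one_sub_ne_zero hζ
    have h1 : ‖ζ‖ < 1 := by simpa using hζ
    have h2 : ‖ζ‖ ^ 2 < 1 := by nlinarith [norm_nonneg ζ]
    change 0 < (cayley w ζ).re
    rw [re_cayley w hζ]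
    have : 0 < ‖1 - ζ‖ := norm_pos_iff.2 h0
    have : 0 < 1 - ‖ζ‖ ^ 2 := by linarith
    positivity
  · intro hz
    have hz' : 0 < z.re := hz
    have h0 : z + conj w ≠ 0 := fun h => by
      have := congrArg Complex.re h
      simp at this
      linarith
    have h1 : w + conj w ≠ 0 := fun h => by
      have := congrArg Complex.re h
      simp at this
      linarith
    -- The inverse map; its value lies in the disc because `|z + conj w|² - |z - w|² = 4 Re z Re w >
    -- 0`.
    refine ⟨(z - w) / (z + conj w), ?_, ?_⟩
    · rw [mem_ball_zero_iff, norm_div, div_lt_one (norm_pos_iff.2 h0)]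
      refine lt_of_pow_lt_pow_left₀ 2 (norm_nonneg _) ?_
      rw [← Complex.normSq_eq_norm_sq, ← Complex.normSq_eq_norm_sq]
      simp [Complex.normSq_apply]
      nlinarith [mul_pos hz' hw']
    · have h3 : 1 - (z - w) / (z + conj w) = (w + conj w) / (z + conj w) := by
        field_simp; ring
      rw [cayley, h3]
      field_simp
      ring

end Cayley

/-! ### The reproducing kernel. -/

/-- The reproducing kernel of the Bergman space. -/
noncomputable def kernelFun (ℓ : ℕ) (w z : ℂ) : ℂ :=
  (2 ^ ℓ * (ℓ + 1) : ℝ) / (z + conj w) ^ (ℓ + 2)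

section Kernel

variable {ℓ : ℕ} {w : ℂ}

theorem add_conj_ne_zero {z : ℂ} (hw : w ∈ rhp) (hz : z ∈ rhp) : z + conj w ≠ 0 := fun h => by
  have := congrArg Complex.re h
  have h1 : 0 < w.re := hw
  have h2 : 0 < z.re := hz
  simp at this
  linarith

theorem kernelFun_differentiableOn (hw : w ∈ rhp) :
    DifferentiableOn ℂ (kernelFun ℓ w) rhp := by
  intro z hz
  refine DifferentiableAt.differentiableWithinAt ?_
  have := add_conj_ne_zero hw hz
  unfold kernelFun
  fun_prop (disch := exact pow_ne_zero _ this)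

/-- The reproducing integrand, pulled back to the disc. -/
theorem kernel_pullback (hw : w ∈ rhp) {ζ : ℂ} (hζ : ζ ∈ Metric.ball (0 : ℂ) 1) (c : ℂ) :
    ‖((2 * w.re : ℝ) : ℂ) / (1 - ζ) ^ 2‖ ^ 2 • ((cayley w ζ).re ^ ℓ / Real.pi) •
      (c * conj (kernelFun ℓ w (cayley w ζ))) =
    ((ℓ + 1) / Real.pi : ℝ) • ((1 - ‖ζ‖ ^ 2) ^ ℓ • (c * ((1 - ζ) ^ (ℓ + 2))⁻¹)) := by
  have h0 := one_sub_ne_zero hζ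
  have hw' : 0 < w.re := hw
  have hu : (w.re : ℂ) ≠ 0 := by exact_mod_cast hw'.ne'
  have hpi : (Real.pi : ℂ) ≠ 0 := by exact_mod_cast Real.pi_ne_zero
  rw [kernelFun, cayley_add_conj w hζ, re_cayley w hζ, norm_div, norm_pow, Complex.norm_real,
    Real.norm_of_nonneg (by positivity), div_pow, pow_right_comm ‖1 - ζ‖]
  -- With `D = 1 - ζ`, the Jacobian contributes `|D|^(-4)`, the weight `|D|^(-2ℓ)` and the
  -- conjugated kernel `(conj D)^(ℓ+2)`. Writing `|D|² = D * conj D`, all powers of `conj D` cancel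
  -- and the holomorphic factor `D^(-(ℓ+2))` remains.
  have hD : ((‖1 - ζ‖ ^ 2 : ℝ) : ℂ) = (1 - ζ) * conj (1 - ζ) := by
    rw [Complex.mul_conj, Complex.normSq_eq_norm_sq]
  set X : ℝ := 1 - ‖ζ‖ ^ 2
  set N : ℝ := ‖1 - ζ‖ ^ 2
  set D : ℂ := 1 - ζ
  have h0' : conj D ≠ 0 := (map_ne_zero _).2 h0
  simp only [Complex.real_smul, map_div₀, map_pow, Complex.conj_ofReal]
  push_cast
  rw [hD]
  generalize conj D = D' at h0' ⊢
  simp only [div_pow, mul_pow]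
  field_simp
  ring

/-- Pulled back to the disc, the second kernel factor cancels `(1 - ζ)^(-(ℓ+2))`, which leaves a
constant times `(1 - |ζ|²)^ℓ`, a bounded function. -/
theorem integrableOn_kernel_sq (hw : w ∈ rhp) :
    IntegrableOn (fun z => (z.re ^ ℓ / Real.pi) • (kernelFun ℓ w z * conj (kernelFun ℓ w z))) rhp := by
  rw [← image_cayley hw, integrableOn_image_holo Metric.isOpen_ball.measurableSet
    (fun z hz => hasDerivAt_cayley w hz) (injOn_cayley hw)]
  have hw' : 0 < w.re := hw
  have hu : (w.re : ℂ) ≠ 0 := by exact_mod_cast hw'.ne'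
  have h1 : IntegrableOn (fun ζ : ℂ => ((ℓ + 1) / Real.pi : ℝ) • ((1 - ‖ζ‖ ^ 2) ^ ℓ •
      (((2 ^ ℓ * (ℓ + 1) : ℝ) : ℂ) / ((2 * w.re : ℝ) : ℂ) ^ (ℓ + 2)))) (Metric.ball (0 : ℂ) 1) := by
    refine IntegrableOn.mono_set ?_ Metric.ball_subset_closedBall
    exact ContinuousOn.integrableOn_compact (isCompact_closedBall _ _)
      (Continuous.continuousOn (by fun_prop))
  refine h1.congr_fun (fun ζ hζ => ?_) Metric.isOpen_ball.measurableSet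
  simp only
  rw [kernel_pullback hw hζ]
  congr 2
  have h0 := one_sub_ne_zero hζ
  rw [kernelFun, cayley_add_conj w hζ]
  push_cast
  simp only [div_pow, mul_pow]
  field_simp

theorem kernelFun_mem (w : rhp) :
    (fun z : rhp => kernelFun ℓ w z) ∈ bergmanSubmodule ℓ := by
  have h1 : IsHolo (fun z : rhp => kernelFun ℓ w z) :=
    ⟨_, kernelFun_differentiableOn w.2, fun _ => rfl⟩
  refine ⟨h1, ?_⟩
  rw [memLp_two_iff_integrable_sq_norm h1.continuous.aestronglyMeasurable]
  have h2 := ((integrable_weightedMeasure (ℓ := ℓ)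
    (fun z => kernelFun ℓ w z * conj (kernelFun ℓ w z))).2 (integrableOn_kernel_sq w.2)).re
  refine h2.congr (ae_of_all _ fun z => ?_)
  simp [Complex.mul_conj, Complex.normSq_eq_norm_sq, -Complex.ofReal_pow]

/-- On the disc the integrand is `(1 - |ζ|²)^ℓ` times a holomorphic function, so the weighted mean
value property evaluates it at `ζ = 0`, the point that `cayley w` sends to `w`. -/
theorem integral_kernel (hw : w ∈ rhp) {F : ℂ → ℂ} (hF : DifferentiableOn ℂ F rhp)
    (hi : IntegrableOn (fun z => (z.re ^ ℓ / Real.pi) • (F z * conj (kernelFun ℓ w z))) rhp) :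
    ∫ z in rhp, (z.re ^ ℓ / Real.pi) • (F z * conj (kernelFun ℓ w z)) = F w := by
  have hb : MeasurableSet (Metric.ball (0 : ℂ) 1) := Metric.isOpen_ball.measurableSet
  rw [← image_cayley hw] at hi ⊢
  rw [integrableOn_image_holo hb (fun z hz => hasDerivAt_cayley w hz) (injOn_cayley hw)] at hi
  rw [integral_image_holo hb (fun z hz => hasDerivAt_cayley w hz) (injOn_cayley hw),
    setIntegral_congr_fun hb (fun ζ hζ => kernel_pullback hw hζ _), integral_smul, integral_disc]
  · rw [cayley_zero, smul_smul]
    have : (ℓ : ℝ) + 1 ≠ 0 := by positivity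
    have e : (ℓ + 1) / Real.pi * (Real.pi / (ℓ + 1)) = 1 := by field_simp
    rw [e]
    simp
  · intro ζ hζ
    have h0 := one_sub_ne_zero hζ
    have h1 : cayley w ζ ∈ rhp := by rw [← image_cayley hw]; exact ⟨ζ, hζ, rfl⟩
    have h2 : DifferentiableAt ℂ (fun ζ => F (cayley w ζ)) ζ :=
      (hF.differentiableAt (isOpen_rhp.mem_nhds h1)).comp ζ
        (hasDerivAt_cayley w hζ).differentiableAt
    have h3 : DifferentiableAt ℂ (fun ζ : ℂ => ((1 - ζ) ^ (ℓ + 2))⁻¹) ζ := by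
      fun_prop (disch := exact pow_ne_zero _ h0)
    exact (h2.mul h3).differentiableWithinAt
  · have h4 := hi.congr_fun (fun ζ hζ => kernel_pullback hw hζ _) hb
    have h5 : ((ℓ + 1) / Real.pi : ℝ) ≠ 0 := by positivity
    exact (integrable_smul_iff h5 _).1 h4

end Kernel

namespace Bergman

/-- The reproducing kernel at `w`, as an element of the Bergman space. -/
noncomputable def kernel (ℓ : ℕ) (w : rhp) : Bergman ℓ := mk _ (kernelFun_mem w)

theorem kernel_apply {ℓ : ℕ} (w z : rhp) : kernel ℓ w z = kernelFun ℓ w z := rfl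

theorem inner_kernel {ℓ : ℕ} (w : rhp) (h : Bergman ℓ) : inner ℂ (kernel ℓ w) h = h w := by
  obtain ⟨F, hF, hE⟩ := h.isHolo
  have hae : (fun z => inner ℂ ((toL2 (kernel ℓ w) : rhp → ℂ) z) ((toL2 h : rhp → ℂ) z))
      =ᵐ[weightedMeasure ℓ] fun z : rhp => F z * conj (kernelFun ℓ w z) := by
    filter_upwards [h.memLp.coeFn_toLp, (kernel ℓ w).memLp.coeFn_toLp] with z hz hz'
    have e1 : (toL2 h : rhp → ℂ) z = h z := hz
    have e2 : (toL2 (kernel ℓ w) : rhp → ℂ) z = kernel ℓ w z := hz'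
    rw [e1, e2, hE, kernel_apply]
    rfl
  have hi : IntegrableOn (fun z => (z.re ^ ℓ / Real.pi) • (F z * conj (kernelFun ℓ w z))) rhp :=
    (integrable_weightedMeasure _).1 ((L2.integrable_inner _ _).congr hae)
  have hin : inner ℂ (kernel ℓ w) h =
      ∫ z, inner ℂ ((toL2 (kernel ℓ w) : rhp → ℂ) z) ((toL2 h : rhp → ℂ) z) ∂weightedMeasure ℓ :=
    L2.inner_def _ _
  rw [hin, integral_congr_ae hae,
    integral_weightedMeasure (fun z => F z * conj (kernelFun ℓ w z))]
  rw [integral_kernel w.2 hF hi, hE]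

end Bergman

/-! ### Symmetry on kernels and selfadjointness with respect to the conjugation. -/

/-- The symmetry of the symbols which expresses that the weighted composition operator is
complex symmetric on the reproducing kernels. -/
def SymbolSymmetric (ℓ : ℕ) (a : ℝ) (f : rhp → ℂ) (g : rhp → rhp) : Prop :=
  ∀ z w : rhp, f z * ((z : ℂ) + g w - Complex.I * a) ^ (ℓ + 2) =
    f w * ((w : ℂ) + g z - Complex.I * a) ^ (ℓ + 2)

theorem add_sub_ne_zero (a : ℝ) (z w : rhp) : (z : ℂ) + w - Complex.I * a ≠ 0 := fun h => by
  have := congrArg Complex.re h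
  have h1 : 0 < (z : ℂ).re := z.2
  have h2 : 0 < (w : ℂ).re := w.2
  simp at this
  linarith

section Kernel

variable {ℓ : ℕ} {a : ℝ} {f : rhp → ℂ} {g : rhp → rhp}

theorem kernel_reflect_apply (ℓ : ℕ) (a : ℝ) (w z : rhp) :
    Bergman.kernel ℓ (reflect a w) z =
      (2 ^ ℓ * (ℓ + 1) : ℝ) / ((z : ℂ) + w - Complex.I * a) ^ (ℓ + 2) := by
  rw [Bergman.kernel_apply, kernelFun]
  congr 2
  simp [reflect]
  ring

theorem conjOp_kernel (ℓ : ℕ) (a : ℝ) (w : rhp) :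
    conjOp ℓ a (Bergman.kernel ℓ w) = Bergman.kernel ℓ (reflect a w) := by
  ext z
  rw [conjOp_apply, kernel_reflect_apply, Bergman.kernel_apply, kernelFun, map_div₀,
    Complex.conj_ofReal, map_pow]
  congr 2
  simp [reflect]
  ring

theorem SymbolSymmetric.kernel_eq (hfg : SymbolSymmetric ℓ a f g) (z w : rhp) :
    f z * Bergman.kernel ℓ (reflect a w) (g z) = f w * Bergman.kernel ℓ (reflect a (g w)) z := by
  rw [kernel_reflect_apply, kernel_reflect_apply, add_comm (g z : ℂ), mul_div_assoc', mul_div_assoc',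
    div_eq_div_iff (pow_ne_zero _ (add_sub_ne_zero a _ _)) (pow_ne_zero _ (add_sub_ne_zero a _ _))]
  linear_combination ((2 ^ ℓ * (ℓ + 1) : ℝ) : ℂ) * hfg z w

theorem symbolSymmetric_of_kernel_eq (h : ∀ z w : rhp,
    f z * Bergman.kernel ℓ (reflect a w) (g z) = f w * Bergman.kernel ℓ (reflect a (g w)) z) :
    SymbolSymmetric ℓ a f g := by
  intro z w
  have h1 := h z w
  rw [kernel_reflect_apply, kernel_reflect_apply, add_comm (g z : ℂ), mul_div_assoc', mul_div_assoc',
    div_eq_div_iff (pow_ne_zero _ (add_sub_ne_zero a _ _)) (pow_ne_zero _ (add_sub_ne_zero a _ _))]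
    at h1
  have hc : ((2 ^ ℓ * (ℓ + 1) : ℝ) : ℂ) ≠ 0 := by
    exact_mod_cast (by positivity : (2 ^ ℓ * (ℓ + 1) : ℝ) ≠ 0)
  refine mul_left_cancel₀ hc ?_
  linear_combination h1

end Kernel

section Abstract

variable {E : Type*} [NormedAddCommGroup E] [InnerProductSpace ℂ E]

theorem adjoint_le_adjoint [CompleteSpace E] {S T : E →ₗ.[ℂ] E} (hS : Dense (S.domain : Set E))
    (hST : S ≤ T) : T.adjoint ≤ S.adjoint := by
  have hT : Dense (T.domain : Set E) := hS.mono hST.1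
  refine LinearPMap.IsFormalAdjoint.le_adjoint hS fun x y => ?_
  have h1 := (LinearPMap.adjoint_isFormalAdjoint hT).symm ⟨x, hST.1 x.2⟩ y
  rwa [← hST.2 (x := x) (y := ⟨x, hST.1 x.2⟩) rfl] at h1

theorem sandwich_mono (C : E →ₗ⋆[ℂ] E) {S T : E →ₗ.[ℂ] E} (hST : S ≤ T) :
    sandwich C S ≤ sandwich C T := by
  refine ⟨fun x hx => hST.1 hx, fun x y hxy => ?_⟩
  exact congrArg C (hST.2 (congrArg C hxy))

end Abstract

section Operator

variable {ℓ : ℕ} {a : ℝ} {f : rhp → ℂ} {g : rhp → rhp} {W : Bergman ℓ →ₗ.[ℂ] Bergman ℓ}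

theorem maxWCO_apply (h : (maxWCO ℓ f g).domain) (z : rhp) :
    maxWCO ℓ f g h z = f z * (h : Bergman ℓ) (g z) := rfl

theorem apply_of_le_maxWCO (hW : W ≤ maxWCO ℓ f g) (h : W.domain) (z : rhp) :
    W h z = f z * (h : Bergman ℓ) (g z) := by
  rw [hW.2 (x := h) (y := ⟨h, hW.1 h.2⟩) rfl]
  rfl

/-- The adjoint maps the kernel at `w` to a multiple of the kernel at `g w`. -/
theorem inner_adjoint_kernel (hW : W ≤ maxWCO ℓ f g) (w : rhp) (h : W.domain) :
    inner ℂ (conj (f w) • Bergman.kernel ℓ (g w)) (h : Bergman ℓ) =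
      inner ℂ (Bergman.kernel ℓ w) (W h) := by
  rw [inner_smul_left, Bergman.inner_kernel, Bergman.inner_kernel, apply_of_le_maxWCO hW,
    Complex.conj_conj]

/-- Both sides of `C W* C = W` are applied to the kernel at `reflect a w`: the left side gives
`K_w`, then `conj (f w) • K_{g w}`, then `f w • K_{reflect a (g w)}`. -/
theorem IsCSelfAdjoint.symbolSymmetric (hC : IsCSelfAdjoint (conjOp ℓ a) W)
    (hW : W ≤ maxWCO ℓ f g) : SymbolSymmetric ℓ a f g := by
  refine symbolSymmetric_of_kernel_eq fun z w => ?_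
  have hk : Bergman.kernel ℓ w ∈ W.adjoint.domain :=
    LinearPMap.mem_adjoint_domain_of_exists _ ⟨_, inner_adjoint_kernel hW w⟩
  have hA : W.adjoint ⟨_, hk⟩ = conj (f w) • Bergman.kernel ℓ (g w) :=
    LinearPMap.adjoint_apply_eq hC.1 _ (inner_adjoint_kernel hW w)
  have hCk : conjOp ℓ a (Bergman.kernel ℓ (reflect a w)) = Bergman.kernel ℓ w := by
    rw [conjOp_kernel, reflect_reflect]
  have hle := hC.2.le
  have hk' : Bergman.kernel ℓ (reflect a w) ∈ (sandwich (conjOp ℓ a) W.adjoint).domain := by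
    change conjOp ℓ a (Bergman.kernel ℓ (reflect a w)) ∈ W.adjoint.domain
    rwa [hCk]
  have h1 := hle.2 (x := ⟨_, hk'⟩) (y := ⟨_, hle.1 hk'⟩) rfl
  have h2 : sandwich (conjOp ℓ a) W.adjoint ⟨_, hk'⟩ =
      conjOp ℓ a (W.adjoint ⟨_, hk⟩) := by
    change conjOp ℓ a (W.adjoint _) = _
    congr 2
    exact Subtype.ext hCk
  have h3 : sandwich (conjOp ℓ a) W.adjoint ⟨_, hk'⟩ z = W ⟨_, hle.1 hk'⟩ z := by rw [h1]
  rw [apply_of_le_maxWCO hW, h2, hA, map_smulₛₗ, conjOp_kernel] at h3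
  simpa using h3.symm

/-- Boundedness makes the adjoint everywhere defined, so only values have to be compared. The value
of `C W* C h` at `z` is found by moving `W*` onto the kernel at `reflect a z`, which `W` maps to a
multiple of a kernel by symmetry. -/
theorem SymbolSymmetric.isCSelfAdjoint (hfg : SymbolSymmetric ℓ a f g)
    (hb : IsBoundedOperator (maxWCO ℓ f g)) : IsCSelfAdjoint (conjOp ℓ a) (maxWCO ℓ f g) := by
  obtain ⟨htop, L, -, hL⟩ := hb
  have hd : Dense ((maxWCO ℓ f g).domain : Set (Bergman ℓ)) := by
    rw [htop]; exact dense_univ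
  have hmem : ∀ h, h ∈ (maxWCO ℓ f g).domain := fun h => by rw [htop]; trivial
  have hadj : ∀ h, h ∈ (maxWCO ℓ f g).adjoint.domain := by
    intro h
    rw [LinearPMap.mem_adjoint_domain_iff]
    refine (innerSL ℂ h).continuous.comp ?_
    exact ((maxWCO ℓ f g).toFun.mkContinuous L hL).continuous
  refine ⟨hd, LinearPMap.ext ?_ ?_⟩
  · ext h
    exact iff_of_true (hadj _) (hmem h)
  · intro h hh hh'
    ext z
    have e1 : sandwich (conjOp ℓ a) (maxWCO ℓ f g).adjoint ⟨h, hh⟩ z =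
      conj ((maxWCO ℓ f g).adjoint ⟨conjOp ℓ a h, hadj _⟩ (reflect a z)) := rfl
    have e2 : maxWCO ℓ f g ⟨Bergman.kernel ℓ (reflect a z), hmem _⟩ =
        f z • Bergman.kernel ℓ (reflect a (g z)) := by
      ext w
      exact hfg.kernel_eq w z
    rw [e1, ← Bergman.inner_kernel, inner_conj_symm,
      LinearPMap.adjoint_isFormalAdjoint hd ⟨conjOp ℓ a h, hadj _⟩
        ⟨Bergman.kernel ℓ (reflect a z), hmem _⟩, e2, inner_smul_right, ← inner_conj_symm,
      Bergman.inner_kernel, conjOp_apply, reflect_reflect, Complex.conj_conj, maxWCO_apply]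

/-- Adjoints reverse inclusions, so enlarging `W` to the maximal operator `M` gives `M = C M* C ≤ C
W* C = W`. -/
theorem IsCSelfAdjoint.eq_maxWCO (hC : IsCSelfAdjoint (conjOp ℓ a) W)
    (hM : IsCSelfAdjoint (conjOp ℓ a) (maxWCO ℓ f g)) (hW : W ≤ maxWCO ℓ f g) :
    W = maxWCO ℓ f g := by
  refine le_antisymm hW ?_
  rw [← hM.2]
  exact (sandwich_mono _ (adjoint_le_adjoint hC.1 hW)).trans hC.2.le

end Operator

/-! ### Solving the functional equation. -/

theorem convex_rhp : Convex ℝ rhp := convex_halfSpace_re_gt 0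

instance : PreconnectedSpace rhp :=
  Subtype.preconnectedSpace convex_rhp.isPreconnected

/-- A continuous function on a preconnected space whose values are `n`-th roots of unity is
constant. -/
theorem eq_of_pow_eq_one {X : Type*} [TopologicalSpace X] [PreconnectedSpace X] {T : X → ℂ}
    (hT : Continuous T) {n : ℕ} (hn : 0 < n) (h1 : ∀ x, T x ^ n = 1) (x y : X) : T x = T y := by
  have hfin : {t : ℂ | t ^ n = 1}.Finite := by
    refine (Polynomial.nthRootsFinset n (1 : ℂ)).finite_toSet.subset fun t ht => ?_
    exact (Polynomial.mem_nthRootsFinset hn (1 : ℂ)).2 ht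
  exact isPreconnected_univ.constant_of_mapsTo hfin.isDiscrete hT.continuousOn
    (fun x _ => h1 x) (Set.mem_univ x) (Set.mem_univ y)

section FunctionalEquation

variable {ℓ : ℕ} {a : ℝ} {f : rhp → ℂ} {g : rhp → rhp}

/-- The quotient of the two sides of the symmetry relation, without the exponent. -/
noncomputable def symbolRatio (a : ℝ) (g : rhp → rhp) (z w : rhp) : ℂ :=
  ((z : ℂ) + g w - Complex.I * a) / ((w : ℂ) + g z - Complex.I * a)

theorem symbolRatio_mul (z w : rhp) :
    symbolRatio a g z w * ((w : ℂ) + g z - Complex.I * a) = (z : ℂ) + g w - Complex.I * a :=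
  div_mul_cancel₀ _ (add_sub_ne_zero a _ _)

theorem symbolRatio_ne_zero (z w : rhp) : symbolRatio a g z w ≠ 0 :=
  div_ne_zero (add_sub_ne_zero a _ _) (add_sub_ne_zero a _ _)

theorem symbolRatio_self (z : rhp) : symbolRatio a g z z = 1 :=
  div_self (add_sub_ne_zero a _ _)

theorem symbolRatio_mul_swap (z w : rhp) : symbolRatio a g z w * symbolRatio a g w z = 1 := by
  rw [symbolRatio, symbolRatio, div_mul_div_comm, mul_comm]
  exact div_self (mul_ne_zero (add_sub_ne_zero a _ _) (add_sub_ne_zero a _ _))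

theorem SymbolSymmetric.ratio_pow (h : SymbolSymmetric ℓ a f g) (z w : rhp) :
    f z * symbolRatio a g z w ^ (ℓ + 2) = f w := by
  rw [symbolRatio, div_pow, mul_div_assoc', div_eq_iff (pow_ne_zero _ (add_sub_ne_zero a _ _))]
  exact h z w

theorem SymbolSymmetric.eq_zero (h : SymbolSymmetric ℓ a f g) {z : rhp} (hz : f z = 0) (w : rhp) :
    f w = 0 := by
  rw [← h.ratio_pow z w, hz, zero_mul]

/-- The product of the ratios around a triangle `z, w, v` has `(ℓ+2)`-th power `1`, since `f z`
times that power is `f z` again. Being continuous in `z`, it is constant, and at `z = w` it equals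
`1`. -/
theorem SymbolSymmetric.ratio_cocycle (h : SymbolSymmetric ℓ a f g) (hg : Continuous g)
    (hf : ∀ z, f z ≠ 0) (z w v : rhp) :
    symbolRatio a g z w * symbolRatio a g w v = symbolRatio a g z v := by
  have hT : Continuous fun z => symbolRatio a g z w * symbolRatio a g w v * symbolRatio a g v z := by
    have h1 : Continuous fun z => symbolRatio a g z w :=
      Continuous.div (by fun_prop) (by fun_prop) fun z => add_sub_ne_zero a _ _
    have h2 : Continuous fun z => symbolRatio a g v z :=
      Continuous.div (by fun_prop) (by fun_prop) fun z => add_sub_ne_zero a _ _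
    fun_prop
  have h1 := eq_of_pow_eq_one hT (n := ℓ + 2) (by omega) (fun z => by
    refine mul_left_cancel₀ (hf z) ?_
    rw [mul_pow, mul_pow, ← mul_assoc, ← mul_assoc, h.ratio_pow, h.ratio_pow, h.ratio_pow,
      mul_one]) z w
  simp only [symbolRatio_self, one_mul, symbolRatio_mul_swap] at h1
  refine mul_right_cancel₀ (symbolRatio_ne_zero (a := a) (g := g) v z) ?_
  rw [h1, symbolRatio_mul_swap]

/-- The ratio is an affine function of its first argument. -/
theorem SymbolSymmetric.exists_affine (h : SymbolSymmetric ℓ a f g) (hg : Continuous g)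
    (hf : ∀ z, f z ≠ 0) (w₀ : rhp) : ∃ c : ℂ, ∀ z : rhp,
      symbolRatio a g z w₀ = 1 + c * ((z : ℂ) - w₀) := by
  -- Clearing denominators in the cocycle identity and substituting the definitions of the ratios at
  -- `(z, w₀)` and `(w, w₀)` eliminates `g z` and `g w`.
  have key : ∀ z w : rhp, (symbolRatio a g w w₀ - 1) * ((z : ℂ) - w₀) =
      (symbolRatio a g z w₀ - 1) * ((w : ℂ) - w₀) := by
    intro z w
    have h1 := h.ratio_cocycle hg hf z w w₀
    have h2 := symbolRatio_mul (a := a) (g := g) z w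
    have h3 := symbolRatio_mul (a := a) (g := g) z w₀
    have h4 := symbolRatio_mul (a := a) (g := g) w w₀
    have h5 : symbolRatio a g w w₀ * ((z : ℂ) + g w - Complex.I * a) =
        symbolRatio a g z w₀ * ((w : ℂ) + g z - Complex.I * a) := by
      rw [← h1, ← h2]; ring
    linear_combination h5 + h3 - h4
  -- At `w = w₀ + 1` the factor `w - w₀` is `1`, so `key` reads off the slope.
  have hw₁ : (w₀ : ℂ) + 1 ∈ rhp := by
    have : 0 < (w₀ : ℂ).re := w₀.2
    change 0 < ((w₀ : ℂ) + 1).re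
    simp
    linarith
  refine ⟨symbolRatio a g ⟨_, hw₁⟩ w₀ - 1, fun z => ?_⟩
  have := key z ⟨_, hw₁⟩
  simp only [add_sub_cancel_left, mul_one] at this
  rw [this]
  ring

end FunctionalEquation

/-! ### Möbius self-maps of the half-plane. -/

section SelfMap

/-- Parameters for which `s ↦ -p - 2 q / (s - p)` maps the half-plane to itself. -/
theorem selfMap_conditions {p q : ℂ} (hp : ∀ s ∈ rhp, s ≠ p)
    (hpq : ∀ s ∈ rhp, 0 < (-p - 2 * q / (s - p)).re) :
    (p.re = 0 ∧ q.im = 0 ∧ q.re < 0) ∨ (p.re < 0 ∧ q.re + ‖q‖ ≤ p.re ^ 2) := by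
  have hp0 : p.re ≤ 0 := by
    by_contra! hc
    exact hp p hc rfl
  -- The positivity of the real part at `s = p + x + iy`, with the denominator `|s - p|²` cleared.
  have key : ∀ x y : ℝ, -p.re < x →
      2 * (q.re * x + q.im * y) < -p.re * (x ^ 2 + y ^ 2) := by
    intro x y hx
    have h1 := hpq (p + (x + y * Complex.I)) (by
      change 0 < (p + (x + y * Complex.I)).re
      simp
      linarith)
    have hx0 : 0 < x := by linarith
    have hN : 0 < x ^ 2 + y ^ 2 := by positivity
    have h2 : (2 * q / (p + (x + y * Complex.I) - p)).re =
        2 * (q.re * x + q.im * y) / (x ^ 2 + y ^ 2) := by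
      rw [add_sub_cancel_left, Complex.div_re]
      simp [Complex.normSq_apply]
      field_simp
    rw [Complex.sub_re, h2, Complex.neg_re, sub_pos, div_lt_iff₀ hN] at h1
    exact h1
  rcases hp0.eq_or_lt with h0 | h0
  · refine Or.inl ⟨h0, ?_⟩
    rw [h0] at key
    have him : q.im = 0 := by
      by_contra hne
      -- This `y` makes the left side zero, and the right side is zero because `p.re = 0`.
      have := key 1 (-q.re / q.im) (by norm_num)
      field_simp at this
      norm_num at this
    refine ⟨him, ?_⟩
    have := key 1 0 (by norm_num)
    norm_num at this
    linarith
  · refine Or.inr ⟨h0, ?_⟩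
    set r : ℝ := -p.re with hr
    have hr0 : 0 < r := by linarith
    -- The choice `y = q.im / r` is the extremal one: it maximizes `2 q.im y - r y²`.
    have h1 : ∀ x : ℝ, r < x → 0 ≤ r ^ 2 * x ^ 2 - 2 * q.re * r * x - q.im ^ 2 := by
      intro x hx
      have h2 := key x (q.im / r) hx
      have h3 : r * (2 * (q.re * x + q.im * (q.im / r))) < r * (r * (x ^ 2 + (q.im / r) ^ 2)) :=
        mul_lt_mul_of_pos_left h2 hr0
      have h4 : r * (q.im / r) = q.im := by field_simp
      nlinarith
    -- Letting `x` decrease to `r` gives the sharp condition, equivalent to `‖q‖² ≤ (r² - q.re)²`.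
    have h2 : 0 ≤ r ^ 2 * r ^ 2 - 2 * q.re * r * r - q.im ^ 2 := by
      have hc : Continuous fun x : ℝ => r ^ 2 * x ^ 2 - 2 * q.re * r * x - q.im ^ 2 := by fun_prop
      have ht : Tendsto (fun x : ℝ => r ^ 2 * x ^ 2 - 2 * q.re * r * x - q.im ^ 2) (𝓝[>] r)
          (𝓝 (r ^ 2 * r ^ 2 - 2 * q.re * r * r - q.im ^ 2)) :=
        (hc.tendsto r).mono_left nhdsWithin_le_nhds
      refine ge_of_tendsto ht ?_
      filter_upwards [self_mem_nhdsWithin] with x hx using h1 x hx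
    have h3 : ‖q‖ ^ 2 = q.re ^ 2 + q.im ^ 2 := by
      rw [← Complex.normSq_eq_norm_sq, Complex.normSq_apply]; ring
    have h4 : ‖q‖ ^ 2 ≤ (r ^ 2 - q.re) ^ 2 := by nlinarith
    have h5 := sq_le_sq.1 h4
    have h6 : q.re ≤ ‖q‖ := Complex.re_le_norm q
    rw [abs_of_nonneg (norm_nonneg q)] at h5
    have h7 : p.re ^ 2 = r ^ 2 := by rw [hr]; ring
    rw [h7]
    -- The negative sign is impossible: it would give `‖q‖ ≤ q.re - r² < q.re`.
    rcases abs_cases (r ^ 2 - q.re) with ⟨e, _⟩ | ⟨e, _⟩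
    · linarith
    · nlinarith [sq_pos_of_pos hr0]

end SelfMap

/-! ### Classification of the symmetric symbols, and its converse. -/

section Classification

variable {ℓ : ℕ} {a : ℝ} {f : rhp → ℂ} {g : rhp → rhp}

theorem SymbolSymmetric.classification (h : SymbolSymmetric ℓ a f g) (hg : Continuous g) :
    (∀ z, f z = 0) ∨ SymbolCase1 ℓ a f g ∨ SymbolCase2 f g ∨ SymbolCase3 ℓ a f g := by
  by_cases hf : ∃ z, f z = 0
  · obtain ⟨z, hz⟩ := hf
    exact Or.inl (h.eq_zero hz)
  push Not at hf
  refine Or.inr ?_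
  set w₀ : rhp := ⟨1, by simp [rhp]⟩
  obtain ⟨c, hc⟩ := h.exists_affine hg hf w₀
  have hfz : ∀ z : rhp, f z * (1 + c * ((z : ℂ) - w₀)) ^ (ℓ + 2) = f w₀ := fun z => by
    rw [← hc, h.ratio_pow]
  have hgz : ∀ z : rhp, (1 + c * ((z : ℂ) - w₀)) * ((w₀ : ℂ) + g z - Complex.I * a) =
      (z : ℂ) + g w₀ - Complex.I * a := fun z => by
    rw [← hc, symbolRatio_mul]
  have hne : ∀ z : rhp, 1 + c * ((z : ℂ) - w₀) ≠ 0 := fun z => by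
    rw [← hc]; exact symbolRatio_ne_zero z w₀
  by_cases hc0 : c = 0
  · subst hc0
    refine Or.inr (Or.inl ⟨g w₀ - w₀, f w₀, ?_, fun z => ⟨?_, ?_⟩⟩)
    · by_contra! hneg
      -- If the translation `γ` had `Re γ < 0`, it would send the point `-Re γ / 2` to real part `Re
      -- γ / 2 < 0`.
      have hz : ((-(((g w₀ : ℂ) - w₀).re / 2) : ℝ) : ℂ) ∈ rhp := by
        change 0 < Complex.re _
        rw [Complex.ofReal_re]
        linarith
      have h1 := hgz ⟨_, hz⟩
      have h2 := congrArg Complex.re h1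
      have h3 : 0 < (g ⟨_, hz⟩ : ℂ).re := (g ⟨_, hz⟩).2
      simp at h2 h3 hneg
      linarith
    · have := hgz z
      linear_combination this
    · simpa using hfz z
  -- For `c ≠ 0`, `g` takes the form `ia + b + D / (z + b)`; the map is constant exactly when `D =
  -- 0`.
  set b : ℂ := 1 / c - w₀ with hb
  set D : ℂ := ((g w₀ : ℂ) - Complex.I * a + w₀ - 1 / c) / c with hD
  have hrho : ∀ z : rhp, 1 + c * ((z : ℂ) - w₀) = c * (z + b) := fun z => by
    rw [hb]; field_simp; ring
  have hzb : ∀ z : rhp, (z : ℂ) + b ≠ 0 := fun z h0 => hne z (by rw [hrho, h0, mul_zero])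
  have hgb : ∀ z : rhp, (g z : ℂ) = Complex.I * a + b + D / (z + b) := fun z => by
    have h1 := hgz z
    rw [hrho] at h1
    refine mul_left_cancel₀ (mul_ne_zero hc0 (hzb z)) ?_
    have h2 : c * (z + b) * (D / (z + b)) = (g w₀ : ℂ) - Complex.I * a + w₀ - 1 / c := by
      have := hzb z
      rw [hD]; field_simp
    have h3 : c * b = 1 - c * w₀ := by rw [hb]; field_simp
    have h4 : c * (1 / c) = 1 := by field_simp
    rw [mul_add _ _ (D / _), h2]
    have h5 : b = 1 / c - w₀ := hb
    linear_combination h1 - (z + b) * h3 - h5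
  have hfb : ∀ z : rhp, f z = f w₀ / c ^ (ℓ + 2) / ((z : ℂ) + b) ^ (ℓ + 2) := fun z => by
    have h1 := hfz z
    have := hzb z
    rw [hrho, mul_pow] at h1
    rw [← h1]
    field_simp
  by_cases hD0 : D = 0
  · refine Or.inl ⟨Complex.I * a + b, f w₀ / c ^ (ℓ + 2), ?_, fun z => ⟨?_, ?_⟩⟩
    · have h1 : 0 < (g w₀ : ℂ).re := (g w₀).2
      rw [hgb w₀, hD0, zero_div, add_zero] at h1
      exact h1
    · rw [hgb z, hD0, zero_div, add_zero]
    · rw [hfb z]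
      congr 2
      ring
  · refine Or.inr (Or.inr ?_)
    -- The parameters `α = -2 / D` and `β / α = -(ia + b)` give `α (z - ia) - β = α (z + b)` and `-2
    -- / (α (z + b)) = D / (z + b)`.
    have hα : -2 / D ≠ 0 := div_ne_zero (by norm_num) hD0
    have hβ : -2 / D * (-(Complex.I * a + b)) / (-2 / D) = -(Complex.I * a + b) := by
      field_simp
    have hden : ∀ z : rhp, -2 / D * ((z : ℂ) - Complex.I * a) - -2 / D * (-(Complex.I * a + b)) =
        -2 / D * (z + b) := fun z => by ring
    refine ⟨-2 / D, -2 / D * (-(Complex.I * a + b)), f w₀ / c ^ (ℓ + 2) * (-2 / D) ^ (ℓ + 2), hα,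
      ?_, fun z => ⟨?_, ?_⟩⟩
    · have hsel := selfMap_conditions (p := -(Complex.I * a + b)) (q := 1 / (-2 / D)) ?_ ?_
      · rw [hβ]
        rwa [norm_div, norm_one] at hsel
      · intro s hs h0
        have hs' : s + Complex.I * a ∈ rhp := by
          have : 0 < s.re := hs
          simpa [rhp] using this
        refine hzb ⟨_, hs'⟩ ?_
        simp only
        linear_combination h0
      · intro s hs
        have hs' : s + Complex.I * a ∈ rhp := by
          have : 0 < s.re := hs
          simpa [rhp] using this
        have h1 : 0 < (g ⟨_, hs'⟩ : ℂ).re := (g ⟨_, hs'⟩).2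
        rw [hgb] at h1
        have h2 := hzb ⟨_, hs'⟩
        convert h1 using 2
        have e : s - -(Complex.I * a + b) = s + Complex.I * a + b := by ring
        rw [e]
        simp only at h2 ⊢
        field_simp
        ring
    · rw [hden, hgb z, hβ]
      have := hzb z
      field_simp
      ring
    · rw [hden, hfb z]
      have := hzb z
      rw [mul_pow, mul_comm ((-2 / D) ^ (ℓ + 2)), mul_div_mul_right _ _ (pow_ne_zero _ hα)]

theorem symbolSymmetric_of_eq_zero (hf : ∀ z, f z = 0) : SymbolSymmetric ℓ a f g := fun z w => by
  rw [hf, hf, zero_mul, zero_mul]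

theorem SymbolCase1.symbolSymmetric (h : SymbolCase1 ℓ a f g) : SymbolSymmetric ℓ a f g := by
  obtain ⟨μ, δ, -, h⟩ := h
  have key : ∀ z w : rhp, f z * ((z : ℂ) + g w - Complex.I * a) ^ (ℓ + 2) = δ := fun z w => by
    have h1 := add_sub_ne_zero a z (g w)
    rw [(h w).1] at h1 ⊢
    rw [(h z).2, div_mul_cancel₀ _ (pow_ne_zero _ h1)]
  exact fun z w => (key z w).trans (key w z).symm

theorem SymbolCase2.symbolSymmetric (h : SymbolCase2 f g) : SymbolSymmetric ℓ a f g := by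
  obtain ⟨γ, lam, -, h⟩ := h
  intro z w
  rw [(h z).2, (h w).2, (h z).1, (h w).1, add_left_comm]

theorem SymbolCase3.symbolSymmetric (h : SymbolCase3 ℓ a f g) : SymbolSymmetric ℓ a f g := by
  obtain ⟨α, β, δ, hα, hc, h⟩ := h
  have hp : (β / α).re ≤ 0 := by
    rcases hc with hc | hc
    · exact hc.1.le
    · exact hc.1.le
  have hne : ∀ z : rhp, α * ((z : ℂ) - Complex.I * a) - β ≠ 0 := fun z h0 => by
    have h1 : (z : ℂ) - Complex.I * a = β / α := by
      rw [eq_div_iff hα]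
      linear_combination h0
    have h2 := congrArg Complex.re h1
    have h3 : 0 < (z : ℂ).re := z.2
    simp at h2
    rw [h2] at h3
    exact absurd hp (not_le.2 (by simpa using h3))
  intro z w
  rw [(h z).2, (h w).2, (h z).1, (h w).1, div_mul_eq_mul_div, div_mul_eq_mul_div,
    div_eq_div_iff (pow_ne_zero _ (hne z)) (pow_ne_zero _ (hne w)), mul_assoc, mul_assoc,
    ← mul_pow, ← mul_pow]
  have hz := hne z
  have hw := hne w
  congr 2
  -- In terms of `A` and `B`, both sides equal `A B / α - 2`.
  set A := α * ((z : ℂ) - Complex.I * a) - β with hA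
  set B := α * ((w : ℂ) - Complex.I * a) - β with hB
  have ez : (z : ℂ) = (A + β) / α + Complex.I * a := by rw [hA]; field_simp; ring
  have ew : (w : ℂ) = (B + β) / α + Complex.I * a := by rw [hB]; field_simp; ring
  rw [ez, ew]
  field_simp
  ring

end Classification

/-! ### Boundedness of the operators in the list. -/

section Bounded

variable {ℓ : ℕ} {f : rhp → ℂ} {g : rhp → rhp}

theorem memLp_two_of_lintegral_lt_top {u : rhp → ℂ} (hu : Continuous u)
    (h : ∫⁻ z, ‖u z‖ₑ ^ 2 ∂weightedMeasure ℓ < ⊤) : MemLp u 2 (weightedMeasure ℓ) := by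
  refine ⟨hu.aestronglyMeasurable, ?_⟩
  rw [eLpNorm_lt_top_iff_lintegral_rpow_enorm_lt_top (by simp) (by simp)]
  simpa using h

theorem Bergman.enorm_sq_eq_lintegral (h : Bergman ℓ) :
    ‖h‖ₑ ^ 2 = ∫⁻ z, ‖h z‖ₑ ^ 2 ∂weightedMeasure ℓ := by
  rw [Bergman.enorm_sq_eq, weightedMeasure, lintegral_withDensity_eq_lintegral_mul _
    (measurable_weight ℓ) ((h.isHolo.continuous.enorm.measurable).pow_const 2)]
  rfl

/-- A square norm estimate for all functions of the Bergman space makes the maximal weighted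
composition operator bounded. -/
theorem isBoundedOperator_of_lintegral_le (hf : IsHolo f) (hg : IsHolo fun z => (g z : ℂ))
    {C : NNReal} (hC : ∀ h : Bergman ℓ,
      ∫⁻ z, ‖f z * h (g z)‖ₑ ^ 2 ∂weightedMeasure ℓ ≤ C * ‖h‖ₑ ^ 2) :
    IsBoundedOperator (maxWCO ℓ f g) := by
  have hmem : ∀ h : Bergman ℓ, h ∈ (maxWCO ℓ f g).domain := by
    intro h
    have h1 : IsHolo fun z => f z * h (g z) := by
      obtain ⟨F, hF, hFE⟩ := hf
      obtain ⟨G, hG, hGE⟩ := hg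
      obtain ⟨H, hH, hHE⟩ := h.isHolo
      have hm : Set.MapsTo G rhp rhp := fun z hz => by
        rw [← hGE ⟨z, hz⟩]; exact (g ⟨z, hz⟩).2
      exact ⟨fun z => F z * H (G z), hF.mul (hH.comp hG hm), fun z => by
        change f z * h (g z) = F z * H (G z)
        rw [hFE, hHE, ← hGE]⟩
    refine ⟨h1, memLp_two_of_lintegral_lt_top h1.continuous ((hC h).trans_lt ?_)⟩
    exact ENNReal.mul_lt_top ENNReal.coe_lt_top (by finiteness)
  -- The `+ 1` only ensures a strictly positive bound, as `C` may be zero.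
  refine ⟨eq_top_iff.2 fun h _ => hmem h, Real.sqrt C + 1, by positivity, fun h => ?_⟩
  have h2 : ‖maxWCO ℓ f g h‖ₑ ^ 2 ≤ C * ‖(h : Bergman ℓ)‖ₑ ^ 2 := by
    rw [Bergman.enorm_sq_eq_lintegral]
    exact hC h
  have h3 : ‖maxWCO ℓ f g h‖ ^ 2 ≤ C * ‖(h : Bergman ℓ)‖ ^ 2 := by
    have := ENNReal.toReal_mono (ENNReal.mul_ne_top ENNReal.coe_ne_top (by finiteness)) h2
    simpa [ENNReal.toReal_mul, ENNReal.toReal_pow] using this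
  have h4 : ‖maxWCO ℓ f g h‖ ≤ Real.sqrt C * ‖(h : Bergman ℓ)‖ := by
    refine abs_le_of_sq_le_sq' ?_ (by positivity) |>.2
    rwa [mul_pow, Real.sq_sqrt (NNReal.coe_nonneg C)]
  linarith [norm_nonneg (h : Bergman ℓ)]

theorem isBoundedOperator_of_rank_one (k : Bergman ℓ) (μ : rhp)
    (hk : ∀ (h : Bergman ℓ) (z : rhp), f z * h (g z) = h μ * k z) :
    IsBoundedOperator (maxWCO ℓ f g) := by
  have hmem : ∀ h : Bergman ℓ, h ∈ (maxWCO ℓ f g).domain := by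
    intro h
    change (fun z => f z * h (g z)) ∈ bergmanSubmodule ℓ
    simp only [hk]
    exact (h μ • k).mem
  refine ⟨eq_top_iff.2 fun h _ => hmem h, ‖Bergman.kernel ℓ μ‖ * ‖k‖ + 1, by positivity,
    fun h => ?_⟩
  have h1 : maxWCO ℓ f g h = (h : Bergman ℓ) μ • k := Bergman.ext fun z => hk h z
  have h2 : ‖(h : Bergman ℓ) μ‖ ≤ ‖Bergman.kernel ℓ μ‖ * ‖(h : Bergman ℓ)‖ := by
    rw [← Bergman.inner_kernel]
    exact norm_inner_le_norm _ _
  rw [h1, norm_smul]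
  nlinarith [norm_nonneg (h : Bergman ℓ), norm_nonneg k]

/-- If `g` is injective and satisfies the Schwarz-Pick inequality, and `f` is dominated by a
power of `g'`, then the weighted composition operator is bounded. -/
theorem isBoundedOperator_of_schwarzPick (hf : IsHolo f) {G G' : ℂ → ℂ}
    (hG : ∀ z ∈ rhp, HasDerivAt G (G' z) z) (hinj : Set.InjOn G rhp) (hGE : ∀ z : rhp, g z = G z)
    (C : NNReal) (hfC : ∀ z : rhp, ‖f z‖ ^ 2 ≤ C * ‖G' z‖ ^ (ℓ + 2))
    (hSP : ∀ z ∈ rhp, z.re * ‖G' z‖ ≤ (G z).re) : IsBoundedOperator (maxWCO ℓ f g) := by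
  have hGd : DifferentiableOn ℂ G rhp := fun z hz =>
    (hG z hz).differentiableAt.differentiableWithinAt
  refine isBoundedOperator_of_lintegral_le hf ⟨G, hGd, hGE⟩ (C := C) fun h => ?_
  obtain ⟨F, hF, hFE⟩ := id hf
  obtain ⟨H, hH, hHE⟩ := h.isHolo
  have hGm : Set.MapsTo G rhp rhp := fun z hz => by
    rw [← hGE ⟨z, hz⟩]; exact (g ⟨z, hz⟩).2
  have hHm : Measurable fun z : rhp => ‖H z‖ₑ ^ 2 := by
    simp only [← hHE]
    exact h.isHolo.continuous.enorm.measurable.pow_const 2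
  have hFm : Measurable fun z : rhp => ‖F z * H (G z)‖ₑ ^ 2 := by
    have : Continuous fun z : rhp => F z * H (G z) :=
      (hF.continuousOn.mul (hH.continuousOn.comp hGd.continuousOn hGm)).comp_continuous
        continuous_subtype_val fun z => z.2
    exact this.enorm.measurable.pow_const 2
  have e1 : ∫⁻ z, ‖f z * h (g z)‖ₑ ^ 2 ∂weightedMeasure ℓ =
      ∫⁻ z in rhp, ENNReal.ofReal (z.re ^ ℓ / Real.pi) * ‖F z * H (G z)‖ₑ ^ 2 := by
    rw [← lintegral_weightedMeasure hFm]
    simp only [hFE, hHE, hGE]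
  have e2 : ‖h‖ₑ ^ 2 = ∫⁻ z in rhp, ENNReal.ofReal (z.re ^ ℓ / Real.pi) * ‖H z‖ₑ ^ 2 := by
    rw [Bergman.enorm_sq_eq_lintegral, ← lintegral_weightedMeasure hHm]
    simp only [hHE]
  have e3 := lintegral_image_holo isOpen_rhp.measurableSet hG hinj
    fun z => ENNReal.ofReal (z.re ^ ℓ / Real.pi) * ‖H z‖ₑ ^ 2
  rw [e1, e2]
  calc ∫⁻ z in rhp, ENNReal.ofReal (z.re ^ ℓ / Real.pi) * ‖F z * H (G z)‖ₑ ^ 2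
      ≤ ∫⁻ z in rhp, C * (ENNReal.ofReal (‖G' z‖ ^ 2) *
          (ENNReal.ofReal ((G z).re ^ ℓ / Real.pi) * ‖H (G z)‖ₑ ^ 2)) := by
        -- Pointwise, with `x = Re z`: `x^ℓ |f|² ≤ C |G'|² (x |G'|)^ℓ ≤ C |G'|² (Re G)^ℓ`, where
        -- `|G'|²` is the Jacobian of `G`.
        refine setLIntegral_mono' isOpen_rhp.measurableSet fun z hz => ?_
        have hz' : 0 < z.re := hz
        rw [enorm_mul, mul_pow, ← mul_assoc, ← mul_assoc, ← mul_assoc]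
        refine mul_le_mul_left ?_ _
        rw [← ofReal_norm, ← ENNReal.ofReal_pow (norm_nonneg _),
          ← ENNReal.ofReal_mul (by positivity), ← ENNReal.ofReal_coe_nnreal,
          ← ENNReal.ofReal_mul (by positivity), ← ENNReal.ofReal_mul (by positivity)]
        refine ENNReal.ofReal_le_ofReal ?_
        have h1 := hfC ⟨z, hz⟩
        rw [hFE] at h1
        have h2 : (z.re * ‖G' z‖) ^ ℓ ≤ (G z).re ^ ℓ :=
          pow_le_pow_left₀ (by positivity) (hSP z hz) ℓ
        calc z.re ^ ℓ / Real.pi * ‖F z‖ ^ 2 ≤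
            z.re ^ ℓ / Real.pi * (C * ‖G' z‖ ^ (ℓ + 2)) := by gcongr
          _ = C * ‖G' z‖ ^ 2 * ((z.re * ‖G' z‖) ^ ℓ / Real.pi) := by rw [mul_pow, pow_add]; ring
          _ ≤ _ := by gcongr
    _ = C * ∫⁻ z in G '' rhp, ENNReal.ofReal (z.re ^ ℓ / Real.pi) * ‖H z‖ₑ ^ 2 := by
        rw [lintegral_const_mul' _ _ ENNReal.coe_ne_top, e3]
    _ ≤ _ := by
        gcongr
        exact hGm.image_subset

theorem isBoundedOperator_of_eq_zero (hf : ∀ z, f z = 0) : IsBoundedOperator (maxWCO ℓ f g) :=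
  isBoundedOperator_of_rank_one 0 ⟨1, by simp [rhp]⟩ fun h z => by
    rw [hf, zero_mul]
    exact (mul_zero _).symm

theorem SymbolCase1.isBoundedOperator {a : ℝ} (h : SymbolCase1 ℓ a f g) :
    IsBoundedOperator (maxWCO ℓ f g) := by
  obtain ⟨μ, δ, hμ, h⟩ := h
  have hc : ((2 ^ ℓ * (ℓ + 1) : ℝ) : ℂ) ≠ 0 := by
    exact_mod_cast (by positivity : (2 ^ ℓ * (ℓ + 1) : ℝ) ≠ 0)
  refine isBoundedOperator_of_rank_one
    ((δ / (2 ^ ℓ * (ℓ + 1) : ℝ)) • Bergman.kernel ℓ (reflect a ⟨μ, hμ⟩)) ⟨μ, hμ⟩ fun u z => ?_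
  have hgz : g z = ⟨μ, hμ⟩ := Subtype.ext (h z).1
  have h1 := add_sub_ne_zero a z ⟨μ, hμ⟩
  rw [hgz, (h z).2, Bergman.smul_apply, kernel_reflect_apply, mul_comm]
  simp only at h1 ⊢
  field_simp

theorem SymbolCase2.isBoundedOperator (hf : IsHolo f) (h : SymbolCase2 f g) :
    IsBoundedOperator (maxWCO ℓ f g) := by
  obtain ⟨γ, lam, hγ, h⟩ := h
  refine isBoundedOperator_of_schwarzPick hf (G := fun z => z + γ) (G' := fun _ => 1)
    (fun z _ => (hasDerivAt_id z).add_const γ) (fun z _ w _ hzw => add_right_cancel hzw)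
    (fun z => (h z).1) (‖lam‖₊ ^ 2) (fun z => ?_) fun z _ => ?_
  · rw [(h z).2]; simp
  · simpa using hγ

/-- Here `t` stands for `z - ia - p`, so that `(t + p).re = Re z` and `2 q / t²` is the derivative
of the map. For `p.re = 0` equality holds. Otherwise, with `r = -p.re`, `x = (t + p).re` and `y =
t.im`, clearing `|t|²` and multiplying by `r` turns the difference of the two sides into `r² x² + (r
y - q.im)² + 2 r x (r² - q.re - ‖q‖) + (r⁴ - 2 r² q.re - q.im²)`, each term of which is nonnegative.
-/
theorem schwarzPick_moebius {p q : ℂ}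
    (hpq : (p.re = 0 ∧ q.im = 0 ∧ q.re < 0) ∨ (p.re < 0 ∧ q.re + ‖q‖ ≤ p.re ^ 2))
    {t : ℂ} (ht : -p.re < t.re) :
    (t + p).re * ‖2 * q / t ^ 2‖ ≤ (-p - 2 * q / t).re := by
  have hp : p.re ≤ 0 := by rcases hpq with h | h <;> exact h.1.le
  have ht0 : 0 < t.re := by linarith
  have hN : 0 < t.re ^ 2 + t.im ^ 2 := by positivity
  have h1 : ‖t‖ ^ 2 = t.re ^ 2 + t.im ^ 2 := by
    rw [← Complex.normSq_eq_norm_sq, Complex.normSq_apply]; ring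
  have h2 : (2 * q / t).re = 2 * (q.re * t.re + q.im * t.im) / (t.re ^ 2 + t.im ^ 2) := by
    rw [Complex.div_re]
    simp [Complex.normSq_apply]
    field_simp
  have hq : ‖q‖ ^ 2 = q.re ^ 2 + q.im ^ 2 := by
    rw [← Complex.normSq_eq_norm_sq, Complex.normSq_apply]; ring
  rw [Complex.sub_re, h2, norm_div, norm_mul, norm_pow, h1, Complex.norm_ofNat, Complex.neg_re,
    Complex.add_re, mul_div_assoc', div_le_iff₀ hN, sub_mul, div_mul_cancel₀ _ hN.ne']
  rcases hpq with ⟨h0, him, hre⟩ | ⟨h0, hle⟩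
  · have hqn : ‖q‖ = -q.re := by
      rw [← abs_of_neg hre, ← sq_eq_sq₀ (norm_nonneg _) (abs_nonneg _), hq, him, sq_abs]
      ring
    rw [h0, him, hqn]
    apply le_of_eq
    ring
  · set r : ℝ := -p.re with hr
    have hr0 : 0 < r := by linarith
    have hpr : p.re = -r := by rw [hr]; ring
    rw [hpr] at hle ⊢
    set x := t.re - r with hx
    have hx0 : 0 < x := by linarith
    have htx : t.re = x + r := by rw [hx]; ring
    rw [htx]
    set y := t.im
    have hle' : q.re + ‖q‖ ≤ r ^ 2 := by linarith [neg_sq r]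
    have h3 : q.im ^ 2 ≤ r ^ 2 * (r ^ 2 - 2 * q.re) := by nlinarith [norm_nonneg q]
    have h4 : 0 ≤ (r * y - q.im) ^ 2 := sq_nonneg _
    have h5 : r * ((x + r + -r) * (2 * ‖q‖)) ≤
        r * (r * ((x + r) ^ 2 + y ^ 2) - 2 * (q.re * (x + r) + q.im * y)) := by
      have h6 : 0 ≤ r * x * (r ^ 2 - q.re - ‖q‖) :=
        mul_nonneg (by positivity) (by linarith)
      have h7 : 0 ≤ r ^ 2 * x ^ 2 := by positivity
      linarith
    exact le_of_mul_le_mul_left h5 hr0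

theorem SymbolCase3.isBoundedOperator {a : ℝ} (hf : IsHolo f) (h : SymbolCase3 ℓ a f g) :
    IsBoundedOperator (maxWCO ℓ f g) := by
  obtain ⟨α, β, δ, hα, hc, h⟩ := h
  set p := β / α with hp
  set q := 1 / α with hq
  have hαp : β = α * p := by rw [hp]; field_simp
  have hp0 : p.re ≤ 0 := by rcases hc with h | h <;> exact h.1.le
  have hden : ∀ z, α * (z - Complex.I * a) - β = α * (z - Complex.I * a - p) := fun z => by
    rw [hαp]; ring
  have hre : ∀ z : ℂ, (z - Complex.I * a - p).re = z.re - p.re := fun z => by simp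
  have ht : ∀ z ∈ rhp, z - Complex.I * a - p ≠ 0 := fun z hz h0 => by
    have h1 := congrArg Complex.re h0
    have h2 : 0 < z.re := hz
    rw [hre, Complex.zero_re] at h1
    linarith
  refine isBoundedOperator_of_schwarzPick hf (G := fun z => -p - 2 * q / (z - Complex.I * a - p))
    (G' := fun z => 2 * q / (z - Complex.I * a - p) ^ 2) (fun z hz => ?_) (fun z hz w hw hzw => ?_)
    -- The exact quotient `|f|² / |G'|^(ℓ+2)`, which does not depend on `z`.
    (fun z => ?_) (‖δ‖₊ ^ 2 / (2 * ‖α‖₊) ^ (ℓ + 2)) (fun z => ?_) fun z hz => ?_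
  · have h1 : HasDerivAt (fun z : ℂ => z - Complex.I * a - p) 1 z :=
      ((hasDerivAt_id z).sub_const _).sub_const _
    have h2 := (((h1.inv (ht z hz)).const_mul (2 * q)).const_sub (-p))
    refine (h2.congr_deriv ?_)
    ring
  · have hq0 : 2 * q ≠ 0 := by rw [hq]; simpa using hα
    have h1 : 2 * q / (z - Complex.I * a - p) = 2 * q / (w - Complex.I * a - p) :=
      sub_right_injective hzw
    rw [div_eq_div_iff (ht z hz) (ht w hw)] at h1
    have h2 := mul_left_cancel₀ hq0 h1
    linear_combination -h2
  · have := ht z z.2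
    rw [(h z).1, hden, hq]
    field_simp
  · have h1 : 0 < ‖(z : ℂ) - Complex.I * a - p‖ := norm_pos_iff.2 (ht z z.2)
    have h2 : 0 < ‖α‖ := norm_pos_iff.2 hα
    apply le_of_eq
    rw [(h z).2, hden, hq]
    push_cast
    simp only [norm_div, norm_mul, norm_pow, norm_one, Complex.norm_ofNat, div_pow,
      mul_pow, one_pow]
    field_simp
    ring
  · have hc' : (p.re = 0 ∧ q.im = 0 ∧ q.re < 0) ∨ (p.re < 0 ∧ q.re + ‖q‖ ≤ p.re ^ 2) := by
      rwa [hq, norm_div, norm_one]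
    have h1 := schwarzPick_moebius hc' (t := z - Complex.I * a - p) (by
      have h2 : 0 < z.re := hz
      rw [hre]
      linarith)
    rw [Complex.add_re, hre, sub_add_cancel] at h1
    exact h1

end Bounded

end HalfPlane

/-! ### The main theorem. -/

theorem mainTheorem5 (ℓ : ℕ) (a : ℝ)
    (f : HalfPlane.rhp → ℂ) (hf : HalfPlane.IsHolo f)
    (g : HalfPlane.rhp → HalfPlane.rhp) (hg : HalfPlane.IsHolo (fun z => (g z : ℂ)))
    (W : HalfPlane.Bergman ℓ →ₗ.[ℂ] HalfPlane.Bergman ℓ) (hW : W ≤ HalfPlane.maxWCO ℓ f g) :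
    (HalfPlane.IsCSelfAdjoint (HalfPlane.conjOp ℓ a) W ↔
      W = HalfPlane.maxWCO ℓ f g ∧
        ((∀ z, f z = 0) ∨ HalfPlane.SymbolCase1 ℓ a f g ∨ HalfPlane.SymbolCase2 f g ∨
          HalfPlane.SymbolCase3 ℓ a f g)) ∧
    (HalfPlane.IsCSelfAdjoint (HalfPlane.conjOp ℓ a) W → HalfPlane.IsBoundedOperator W) := by
  have hsym : ((∀ z, f z = 0) ∨ HalfPlane.SymbolCase1 ℓ a f g ∨ HalfPlane.SymbolCase2 f g ∨
      HalfPlane.SymbolCase3 ℓ a f g) →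
      HalfPlane.SymbolSymmetric ℓ a f g ∧
        HalfPlane.IsBoundedOperator (HalfPlane.maxWCO ℓ f g) := by
    rintro (h | h | h | h)
    · exact ⟨HalfPlane.symbolSymmetric_of_eq_zero h, HalfPlane.isBoundedOperator_of_eq_zero h⟩
    · exact ⟨h.symbolSymmetric, h.isBoundedOperator⟩
    · exact ⟨h.symbolSymmetric, h.isBoundedOperator hf⟩
    · exact ⟨h.symbolSymmetric, h.isBoundedOperator hf⟩
  have hgc : Continuous g := Continuous.subtype_mk hg.continuous fun z => (g z).2
  have main : HalfPlane.IsCSelfAdjoint (HalfPlane.conjOp ℓ a) W →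
      W = HalfPlane.maxWCO ℓ f g ∧
        ((∀ z, f z = 0) ∨ HalfPlane.SymbolCase1 ℓ a f g ∨ HalfPlane.SymbolCase2 f g ∨
          HalfPlane.SymbolCase3 ℓ a f g) := fun hC => by
    have hc := (hC.symbolSymmetric hW).classification hgc
    obtain ⟨hs, hb⟩ := hsym hc
    exact ⟨hC.eq_maxWCO (hs.isCSelfAdjoint hb) hW, hc⟩
  refine ⟨⟨main, ?_⟩, fun hC => ?_⟩
  · rintro ⟨rfl, hc⟩
    obtain ⟨hs, hb⟩ := hsym hc
    exact hs.isCSelfAdjoint hb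
  · obtain ⟨rfl, hc⟩ := main hC
    exact (hsym hc).2
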